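/- Let $X$ be a compact metric space, $T:X\to X$ a homeomorphism, and $\mu$ a $T$-invariant ergodic Borel probability measure on $X$. For a map $A:X\to GL(2,\mathbb R)$ put $A^0(x)=\mathrm{Id}$ and, for $n\ge 1$, $A^n(x)=A(T^{n-1}x)\cdots A(Tx)A(x)$ and $A^{-n}(x)=(A^n(T^{-n}x))^{-1}$. The cocycle $A$ (over $T$) has *dominated splitting* if there are a continuous decomposition $\mathbb R^2=E(x)\oplus F(x)$, $x\in X$, into lines with $A(x)E(x)=E(Tx)$ and $A(x)F(x)=F(Tx)$ for all $x$, and an integer $l\ge 1$ such that $$\|A^l(x)|_{E(x)}\|\cdot\|A^{-l}(T^lx)|_{F(T^lx)}\|<\tfrac12\qquad\text{for all }x\in X.$$ The upper Lyapunov exponent $\lambda^+(A)$ is the number with $\lim_{n\to\infty}\frac1n\log\|A^n(x)\|=\lambda^+(A)$ for $\mu$-almost every $x$. Let $R_\theta$ be the rotation of $\mathbb R^2$ of angle $\theta$ and $A_\theta(x)=A(x)R_\theta$. **Theorem.** Let $A:X\to GL^+(2,\mathbb R)$ (matrices of positive determinant) be continuous with dominated splitting. Then the set $\mathcal U=\{\theta\in\mathbb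 R:\ A_\theta\text{ has dominated splitting}\}$ is an open subset of $\mathbb R$ containing $0$; for every $\theta\in\mathcal U$ the exponent $\lambda^+(A_\theta)\in\mathbb R$ exists; and the function $\mathcal U\ni\theta\mapsto\lambda^+(A_\theta)$ is real analytic, and strictly concave on every interval contained in $\mathcal U$. -/

import Mathlib

open Filter Topology MeasureTheory

noncomputable section

namespace LinearCocycle

/-- The Euclidean plane. -/
abbrev Plane : Type := EuclideanSpace ℝ (Fin 2)

/-- An invertible real `2 × 2` matrix, acting on column vectors of the Euclidean plane. -/
def act (g : GL (Fin 2) ℝ) : Plane →L[ℝ] Plane :=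
  Matrix.toEuclideanCLM (n := Fin 2) (𝕜 := ℝ) (g : Matrix (Fin 2) (Fin 2) ℝ)

/-- The operator norm `‖g|V‖` of the restriction of `g` to a subspace `V` of the plane. -/
def normOn (g : GL (Fin 2) ℝ) (V : Submodule ℝ Plane) : ℝ :=
  ‖(act g).comp V.subtypeL‖

/-- The rotation matrix of angle `θ`. -/
def rot (θ : ℝ) : GL (Fin 2) ℝ :=
  Matrix.GeneralLinearGroup.mkOfDetNeZero
    !![Real.cos θ, -Real.sin θ; Real.sin θ, Real.cos θ]
    (by
      have h : Real.cos θ * Real.cos θ + Real.sin θ * Real.sin θ = 1 := by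
        nlinarith [Real.sin_sq_add_cos_sq θ]
      simp [Matrix.det_fin_two_of, h])

section Cocycle

variable {X : Type*} [TopologicalSpace X]

/-- The forward iterates `A^n(x) = A(T^{n-1} x) ⋯ A(T x) A(x)`, with `A^0(x) = Id`. -/
def iter (T : X ≃ₜ X) (A : X → GL (Fin 2) ℝ) : ℕ → X → GL (Fin 2) ℝ
  | 0, _ => 1
  | n + 1, x => A (T^[n] x) * iter T A n x

/-- The backward iterates
`A^{-n}(x) = A(T^{-n} x)⁻¹ A(T^{-(n-1)} x)⁻¹ ⋯ A(T^{-1} x)⁻¹`, with `A^{-0}(x) = Id`. -/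
def backIter (T : X ≃ₜ X) (A : X → GL (Fin 2) ℝ) : ℕ → X → GL (Fin 2) ℝ
  | 0, _ => 1
  | n + 1, x => (A (T.symm^[n + 1] x))⁻¹ * backIter T A n x

/-- A continuous field of lines in the plane: locally, it is spanned by a continuous
nowhere vanishing vector field. -/
def IsContinuousLineField (E : X → Submodule ℝ Plane) : Prop :=
  ∀ x₀ : X, ∃ V ∈ 𝓝 x₀, ∃ v : X → Plane, ContinuousOn v V ∧
    ∀ x ∈ V, v x ≠ 0 ∧ E x = Submodule.span ℝ {v x}

/-- The cocycle generated by `A` over `T` has dominated splitting: there is a continuous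
invariant decomposition `ℝ² = E(x) ⊕ F(x)` into lines such that, for some `l ≥ 1` and all `x`,
`‖A^l(x)|E(x)‖ · ‖A^{-l}(T^l x)|F(T^l x)‖ < 1/2`. -/
def HasDominatedSplitting (T : X ≃ₜ X) (A : X → GL (Fin 2) ℝ) : Prop :=
  ∃ E F : X → Submodule ℝ Plane,
    IsContinuousLineField E ∧ IsContinuousLineField F ∧
    (∀ x, IsCompl (E x) (F x)) ∧
    (∀ x, Module.finrank ℝ (E x) = 1 ∧ Module.finrank ℝ (F x) = 1) ∧
    (∀ x, (E x).map (act (A x)).toLinearMap = E (T x) ∧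
      (F x).map (act (A x)).toLinearMap = F (T x)) ∧
    ∃ l : ℕ, 1 ≤ l ∧ ∀ x,
      normOn (iter T A l x) (E x) * normOn (backIter T A l (T^[l] x)) (F (T^[l] x)) < 1 / 2

/-- `L` is the upper Lyapunov exponent of the cocycle generated by `A` over `T`, with respect
to the (ergodic) measure `μ`: for `μ`-almost every `x`, `(1/n) log ‖A^n(x)‖` converges to `L`. -/
def IsUpperLyapunovExponent [MeasurableSpace X] (μ : Measure X) (T : X ≃ₜ X)
    (A : X → GL (Fin 2) ℝ) (L : ℝ) : Prop :=
  ∀ᵐ x ∂μ, Tendsto (fun n : ℕ => (1 / (n : ℝ)) * Real.log ‖act (iter T A n x)‖) atTop (𝓝 L)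

/-- The upper Lyapunov exponent is unique. -/
theorem IsUpperLyapunovExponent.unique [MeasurableSpace X] {μ : Measure X}
    [IsProbabilityMeasure μ] {T : X ≃ₜ X} {A : X → GL (Fin 2) ℝ} {L L' : ℝ}
    (h : IsUpperLyapunovExponent μ T A L) (h' : IsUpperLyapunovExponent μ T A L') : L = L' := by
  obtain ⟨x, hx, hx'⟩ := (h.and h').exists
  exact tendsto_nhds_unique hx hx'

open Classical in
/-- The upper Lyapunov exponent `λ⁺(A)` (with the value `0` if there is none). -/
def upperLyapunovExponent [MeasurableSpace X] (μ : Measure X) (T : X ≃ₜ X)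
    (A : X → GL (Fin 2) ℝ) : ℝ :=
  if h : ∃ L : ℝ, IsUpperLyapunovExponent μ T A L then h.choose else 0

/-- The rotated cocycle `A_θ(x) = A(x) R_θ`. -/
def rotated (A : X → GL (Fin 2) ℝ) (θ : ℝ) : X → GL (Fin 2) ℝ :=
  fun x => A x * rot θ

end Cocycle

end LinearCocycle

end

/-!
# Analyticity and concavity of the Lyapunov exponent of a rotated dominated cocycle

A dominated splitting is encoded by the continuous field `P` of projections onto the strong line
field along the weak one (`IsDominatedAlong`); this is an idempotent of the Banach algebra of
continuous fields of endomorphisms of the plane, intertwined by the cocycle. After `n` steps the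
linearised graph transform at `P` halves the norm, so the implicit function theorem provides, for
every nearby cocycle, an invariant idempotent near `P` (`eventually_exists_conj_invariant`). Hence
domination persists under small rotations, with the same `n` and with nearby projections
(`IsDominatedAlong.eventually_rotated`), and the set of dominated parameters is open.

The norm of the iterates of a dominated cocycle is comparable to the stretching of the strong line,
whose logarithm is a Birkhoff sum. By Birkhoff's theorem the exponent exists, and it is the growth
rate of the stretching (`IsDominatedAlong.isUpperLyapunovExponent`). Let `v` and `w` be unit vectors
spanning the strong lines of `A` at `x` and at `T^N x`, with `N` a multiple of `n`. As the strong
lines of `A_φ` are close to those of `A` for small `φ`, the coefficient `⟨w, A_φ^N(x) v⟩` is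
comparable to the stretching, with constants independent of `N`; in particular it grows at the rate
of the exponent and does not vanish (`IsDominatedAlong.le_abs_inner_iter`).

Since `R_φ = cos φ (1 + tan φ J)`, this coefficient is `(cos φ)^N q(t)` with `t = tan φ` and `q` a
polynomial of degree at most `N`. All the roots of `q` are real: on the projective line, for
`Im z > 0`, the matrix `1 + z J` maps the closed upper half plane into its interior, and matrices of
positive determinant preserve the half plane (`im_mul_imForm_polyVec_pos`). No root lies in a fixed
neighbourhood of `0`. Therefore `(1/N) log |q(t) / q(0)|` is there a power series in `t`, with
coefficients bounded independently of `N`, and with nonpositive coefficient of `t²`: the latter is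
`-(1/2N) ∑ r⁻²`, summed over the roots `r`. These properties pass to the limit
(`exists_hasSum_of_tendsto`), and
`λ⁺(A_φ) = λ⁺(A) + log (cos φ) + G (tan φ)` near `0`, with `G` analytic and `G'' 0 ≤ 0`. So the
exponent is analytic with second derivative at most `-1` at `0`, and likewise at every dominated
parameter, since `A_θ` can take the place of `A`.
-/

namespace LinearCocycle

/-! ### Birkhoff's pointwise ergodic theorem -/

section Birkhoff

variable {X : Type*}

/-- The running maximum `max (0, S₁, …, Sₙ)` of the Birkhoff sums of `φ`, defined through the
recursion `Mₙ₊₁ = max (0, φ + Mₙ ∘ f)`. -/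
def birkhoffMax (f : X → X) (φ : X → ℝ) : ℕ → X → ℝ
  | 0, _ => 0
  | n + 1, x => max 0 (φ x + birkhoffMax f φ n (f x))

theorem birkhoffMax_nonneg (f : X → X) (φ : X → ℝ) (n : ℕ) (x : X) :
    0 ≤ birkhoffMax f φ n x := by
  cases n with
  | zero => exact le_rfl
  | succ n => exact le_max_left _ _

theorem birkhoffMax_le_succ (f : X → X) (φ : X → ℝ) (n : ℕ) (x : X) :
    birkhoffMax f φ n x ≤ birkhoffMax f φ (n + 1) x := by
  induction n generalizing x with
  | zero => exact le_max_left _ _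
  | succ n ih => exact max_le_max le_rfl (by gcongr; exact ih _)

theorem birkhoffSum_le_birkhoffMax (f : X → X) (φ : X → ℝ) (n : ℕ) (x : X) :
    birkhoffSum f φ n x ≤ birkhoffMax f φ n x := by
  induction n generalizing x with
  | zero => simp [birkhoffSum_zero, birkhoffMax]
  | succ n ih =>
    rw [birkhoffSum_succ']
    exact le_trans (by gcongr; exact ih _) (le_max_right _ _)

theorem birkhoffMax_bddAbove_iff (f : X → X) (φ : X → ℝ) (x : X) :
    BddAbove (Set.range fun n => birkhoffMax f φ n (f x)) ↔
      BddAbove (Set.range fun n => birkhoffMax f φ n x) := by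
  constructor
  · rintro ⟨C, hC⟩
    refine ⟨max 0 (φ x + C), ?_⟩
    rintro _ ⟨n, rfl⟩
    refine (birkhoffMax_le_succ f φ n x).trans (max_le_max le_rfl ?_)
    gcongr
    exact hC ⟨n, rfl⟩
  · rintro ⟨C, hC⟩
    refine ⟨C - φ x, ?_⟩
    rintro _ ⟨n, rfl⟩
    have h1 : birkhoffMax f φ (n + 1) x ≤ C := hC ⟨n + 1, rfl⟩
    have h2 : φ x + birkhoffMax f φ n (f x) ≤ birkhoffMax f φ (n + 1) x := le_max_right _ _
    simp only
    linarith

variable [MeasurableSpace X] {μ : Measure X} {f : X → X} {φ : X → ℝ}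

theorem measurable_birkhoffMax (hf : Measurable f) (hφ : Measurable φ) (n : ℕ) :
    Measurable (birkhoffMax f φ n) := by
  induction n with
  | zero => exact measurable_const
  | succ n ih => exact measurable_const.max (hφ.add (ih.comp hf))

theorem integrable_birkhoffMax (hf : MeasurePreserving f μ μ) (hφ : Integrable φ μ) (n : ℕ) :
    Integrable (birkhoffMax f φ n) μ := by
  induction n with
  | zero => exact integrable_zero _ _ _
  | succ n ih =>
    exact (integrable_zero X ℝ μ).sup (hφ.add (hf.integrable_comp_of_integrable ih))

/-- If the running maxima were unbounded on a set of full measure, the differences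
`Mₙ₊₁ - Mₙ ∘ f = max (-Mₙ ∘ f, φ)`, whose integrals are nonnegative by invariance, would decrease
to `φ`, forcing `0 ≤ ∫ φ`. By ergodicity the only alternative is boundedness almost everywhere. -/
theorem ae_bddAbove_birkhoffMax (hf : Ergodic f μ) (hm : Measurable φ) (hφ : Integrable φ μ)
    (hneg : ∫ x, φ x ∂μ < 0) :
    ∀ᵐ x ∂μ, BddAbove (Set.range fun n => birkhoffMax f φ n x) := by
  have hmp := hf.toMeasurePreserving
  have hms : MeasurableSet {x | BddAbove (Set.range fun n => birkhoffMax f φ n x)} :=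
    measurableSet_bddAbove_range fun n => measurable_birkhoffMax hmp.measurable hm n
  have hinv : f ⁻¹' {x | BddAbove (Set.range fun n => birkhoffMax f φ n x)} =
      {x | BddAbove (Set.range fun n => birkhoffMax f φ n x)} := by
    ext x
    exact birkhoffMax_bddAbove_iff f φ x
  rcases hf.toPreErgodic.aeconst_set hms hinv |> eventuallyConst_set.1 with h | h
  · exact h
  · exfalso
    have hlim : ∀ᵐ x ∂μ, Tendsto
        (fun n => birkhoffMax f φ (n + 1) x - birkhoffMax f φ n (f x)) atTop (𝓝 (φ x)) := by
      filter_upwards [h] with x hx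
      have hx' : ¬ BddAbove (Set.range fun n => birkhoffMax f φ n (f x)) := by
        rw [birkhoffMax_bddAbove_iff]; exact hx
      have htop := tendsto_atTop_atTop_of_monotone' (monotone_nat_of_le_succ
        fun n => birkhoffMax_le_succ f φ n (f x)) hx'
      refine tendsto_const_nhds.congr' ?_
      filter_upwards [htop.eventually_ge_atTop (-φ x)] with n hn
      have : birkhoffMax f φ (n + 1) x = φ x + birkhoffMax f φ n (f x) :=
        max_eq_right (by linarith)
      linarith
    have hbd : ∀ n, ∀ᵐ x ∂μ,
        ‖birkhoffMax f φ (n + 1) x - birkhoffMax f φ n (f x)‖ ≤ |φ x| := by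
      intro n
      refine Eventually.of_forall fun x => ?_
      have h0 := birkhoffMax_nonneg f φ n (f x)
      have h1 : birkhoffMax f φ (n + 1) x = max 0 (φ x + birkhoffMax f φ n (f x)) := rfl
      rw [Real.norm_eq_abs, abs_le, h1]
      constructor
      · have := le_max_right 0 (φ x + birkhoffMax f φ n (f x))
        have := neg_abs_le (φ x)
        linarith
      · rw [sub_le_iff_le_add]
        exact max_le (by positivity) (by gcongr; exact le_abs_self _)
    have hconv := tendsto_integral_of_dominated_convergence (fun x => |φ x|)
      (fun n => ((measurable_birkhoffMax hmp.measurable hm (n + 1)).sub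
        ((measurable_birkhoffMax hmp.measurable hm n).comp
          hmp.measurable)).aestronglyMeasurable) hφ.abs hbd hlim
    refine absurd (ge_of_tendsto' hconv fun n => ?_) (not_le.2 hneg)
    have hi := integrable_birkhoffMax hmp hφ n
    have hc : ∫ x, birkhoffMax f φ n (f x) ∂μ = ∫ x, birkhoffMax f φ n x ∂μ := by
      have := integral_map (μ := μ) hmp.measurable.aemeasurable (f := birkhoffMax f φ n)
        (measurable_birkhoffMax hmp.measurable hm n).aestronglyMeasurable
      rw [hmp.map_eq] at this
      exact this.symm
    rw [integral_sub' (integrable_birkhoffMax hmp hφ (n + 1))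
      (hmp.integrable_comp_of_integrable hi)]
    simp only [Function.comp_apply]
    rw [hc, sub_nonneg]
    exact integral_mono hi (integrable_birkhoffMax hmp hφ (n + 1)) (birkhoffMax_le_succ f φ n)

variable [IsProbabilityMeasure μ]

/-- The Birkhoff sums of `φ - c` are bounded above almost everywhere, as `φ - c` has negative
integral. -/
theorem ae_eventually_birkhoffAverage_le (hf : Ergodic f μ) (hm : Measurable φ)
    (hφ : Integrable φ μ) {c : ℝ} (hc : ∫ x, φ x ∂μ < c) :
    ∀ᵐ x ∂μ, ∀ ε > 0, ∀ᶠ n : ℕ in atTop, (1 / (n : ℝ)) * birkhoffSum f φ n x ≤ c + ε := by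
  have hneg : ∫ x, (φ x - c) ∂μ < 0 := by
    rw [integral_sub hφ (integrable_const c)]
    simpa using hc
  filter_upwards [ae_bddAbove_birkhoffMax hf (hm.sub measurable_const)
    (hφ.sub (integrable_const c)) hneg] with x hx ε hε
  obtain ⟨C, hC⟩ := hx
  obtain ⟨N, hN⟩ := exists_nat_gt (C / ε)
  filter_upwards [eventually_ge_atTop (max N 1)] with n hn
  have hn1 : (1 : ℝ) ≤ n := by exact_mod_cast (le_max_right N 1).trans hn
  have hnN : (N : ℝ) ≤ n := by exact_mod_cast (le_max_left N 1).trans hn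
  have h1 : birkhoffSum f (fun x => φ x - c) n x ≤ C :=
    (birkhoffSum_le_birkhoffMax _ _ n x).trans (hC ⟨n, rfl⟩)
  have h2 : birkhoffSum f (fun x => φ x - c) n x = birkhoffSum f φ n x - n * c := by
    simp [birkhoffSum, Finset.sum_sub_distrib]
  have h3 : C ≤ n * ε := by
    rw [div_lt_iff₀ hε] at hN
    nlinarith
  rw [one_div, inv_mul_le_iff₀ (by linarith)]
  nlinarith

/-- Birkhoff's pointwise ergodic theorem for an ergodic transformation. -/
theorem ae_tendsto_birkhoffAverage (hf : Ergodic f μ) (hm : Measurable φ)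
    (hφ : Integrable φ μ) :
    ∀ᵐ x ∂μ, Tendsto (fun n : ℕ => (1 / (n : ℝ)) * birkhoffSum f φ n x) atTop
      (𝓝 (∫ x, φ x ∂μ)) := by
  have hup : ∀ᵐ x ∂μ, ∀ k : ℕ, ∀ ε > 0, ∀ᶠ n : ℕ in atTop,
      (1 / (n : ℝ)) * birkhoffSum f φ n x ≤ ∫ x, φ x ∂μ + 1 / ((k : ℝ) + 1) + ε :=
    ae_all_iff.2 fun k => ae_eventually_birkhoffAverage_le hf hm hφ
      (lt_add_of_pos_right _ (by positivity))
  have hlow : ∀ᵐ x ∂μ, ∀ k : ℕ, ∀ ε > 0, ∀ᶠ n : ℕ in atTop,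
      (1 / (n : ℝ)) * birkhoffSum f (-φ) n x ≤ ∫ x, (-φ) x ∂μ + 1 / ((k : ℝ) + 1) + ε :=
    ae_all_iff.2 fun k => ae_eventually_birkhoffAverage_le hf hm.neg hφ.neg
      (lt_add_of_pos_right _ (by positivity))
  filter_upwards [hup, hlow] with x h1 h2
  rw [tendsto_order]
  constructor
  · intro a ha
    obtain ⟨k, hk⟩ := exists_nat_one_div_lt (show 0 < (∫ x, φ x ∂μ - a) / 2 by linarith)
    filter_upwards [h2 k ((∫ x, φ x ∂μ - a) / 2) (by linarith)] with n hn
    rw [birkhoffSum_neg] at hn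
    simp only [Pi.neg_apply, integral_neg] at hn
    linarith
  · intro a ha
    obtain ⟨k, hk⟩ := exists_nat_one_div_lt (show 0 < (a - ∫ x, φ x ∂μ) / 2 by linarith)
    filter_upwards [h1 k ((a - ∫ x, φ x ∂μ) / 2) (by linarith)] with n hn
    linarith

end Birkhoff

/-! ### Graph transform in a Banach algebra -/

section BanachAlgebra

theorem isUnit_one_sub_of_norm_pow_lt_one {R : Type*} [NormedRing R] [CompleteSpace R]
    {K : R} {n : ℕ} (h : ‖K ^ n‖ < 1) : IsUnit (1 - K) := by
  have h1 : IsUnit (1 - K ^ n) := ⟨Units.oneSub _ h, rfl⟩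
  have h2 := mul_neg_geom_sum K n
  have h3 := geom_sum_mul_neg K n
  have hc : Commute (1 - K) (∑ i ∈ Finset.range n, K ^ i) := h2.trans h3.symm
  rw [← h2, hc.isUnit_mul_iff] at h1
  exact h1.1

variable {R : Type*} [NormedRing R] [NormedAlgebra ℝ R]

/-- The linearised graph transform `H ↦ τ⁻¹ (τ(1 - P) B H B⁻¹ τP)`. -/
noncomputable def linGraphTransform (τ : R ≃A[ℝ] R) (P B C : R) : R →L[ℝ] R :=
  (τ.symm : R →L[ℝ] R) ∘L (ContinuousLinearMap.mul ℝ R (τ (1 - P) * B)) ∘L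
    ((ContinuousLinearMap.mul ℝ R).flip (C * τ P))

theorem linGraphTransform_apply (τ : R ≃A[ℝ] R) (P B C H : R) :
    linGraphTransform τ P B C H = τ.symm (τ (1 - P) * B * (H * (C * τ P))) := rfl

/-- The part of `B (P + L)` landing in the range of `τP`, completed on the range of `1 - P` so as
to be invertible near `(B₀, 0)`. -/
noncomputable def graphDenom (τ : R ≃A[ℝ] R) (P B₀ : R) (z : R × R) : R :=
  τ P * z.1 * (P + z.2) + τ (1 - P) * B₀ * (1 - P)

/-- The graph transform: the graph of `L` over the range of `P` is sent by `B` to the graph of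
`graphTransform τ P B₀ (B, L)` transported by `τ`. -/
noncomputable def graphTransform (τ : R ≃A[ℝ] R) (P B₀ : R) (z : R × R) : R :=
  τ.symm (τ (1 - P) * z.1 * (P + z.2) * Ring.inverse (graphDenom τ P B₀ z) * τ P)

variable {τ : R ≃A[ℝ] R} {P : R} {B₀ : Rˣ}

theorem graphDenom_base (hP : P * P = P) (hPB : τ P * B₀ = B₀ * P) :
    graphDenom τ P B₀ (B₀, 0) = B₀ := by
  have h : τ (1 - P) * (B₀ : R) = B₀ * (1 - P) := by
    rw [map_sub, map_one, sub_mul, one_mul, hPB, mul_sub, mul_one]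
  simp only [graphDenom, add_zero, hPB, h]
  simp only [mul_assoc, hP, mul_sub, sub_mul, mul_one]
  abel

variable [CompleteSpace R]

theorem contDiffAt_graphTransform (hP : P * P = P) (hPB : τ P * B₀ = B₀ * P) :
    ContDiffAt ℝ 1 (graphTransform τ P (B₀ : R)) ((B₀ : R), 0) := by
  have h1 : ContDiffAt ℝ 1 (graphDenom τ P (B₀ : R)) ((B₀ : R), 0) := by
    unfold graphDenom
    fun_prop
  have h2 : ContDiffAt ℝ 1 Ring.inverse (graphDenom τ P (B₀ : R) ((B₀ : R), 0)) := by
    rw [graphDenom_base hP hPB]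
    exact contDiffAt_ringInverse ℝ B₀
  have h3 : ContDiffAt ℝ 1 (fun z => Ring.inverse (graphDenom τ P (B₀ : R) z)) ((B₀ : R), 0) :=
    h2.comp _ h1
  have h4 : ContDiffAt ℝ 1 (fun z : R × R => τ (1 - P) * z.1 * (P + z.2)) ((B₀ : R), 0) := by
    fun_prop
  exact (τ.symm : R →L[ℝ] R).contDiff.contDiffAt.comp _ ((h4.mul h3).mul contDiffAt_const)

/-- The derivative with respect to the graph, at the invariant graph `0`. The derivative of the
denominator does not contribute, as the numerator vanishes there. -/
theorem hasFDerivAt_graphTransform (hP : P * P = P) (hPB : τ P * B₀ = B₀ * P) :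
    HasFDerivAt (fun L => graphTransform τ P (B₀ : R) ((B₀ : R), L))
      (linGraphTransform τ P B₀ ↑B₀⁻¹) 0 := by
  have hg : DifferentiableAt ℝ (fun L => Ring.inverse (graphDenom τ P (B₀ : R) ((B₀ : R), L)))
      (0 : R) := by
    have h1 : DifferentiableAt ℝ (fun L => graphDenom τ P (B₀ : R) ((B₀ : R), L)) (0 : R) := by
      unfold graphDenom
      fun_prop
    have h2 : DifferentiableAt ℝ Ring.inverse (graphDenom τ P (B₀ : R) ((B₀ : R), 0)) := by
      rw [graphDenom_base hP hPB]
      exact (contDiffAt_ringInverse ℝ B₀ (n := 1)).differentiableAt (by simp)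
    exact DifferentiableAt.comp (0 : R) h2 h1
  have h0 : τ (1 - P) * (B₀ : R) * P = 0 := by
    rw [map_sub, map_one, sub_mul, one_mul, hPB, sub_mul, mul_assoc, hP, sub_self]
  have hf : HasFDerivAt (fun L : R => τ (1 - P) * (B₀ : R) * (P + L))
      (ContinuousLinearMap.mul ℝ R (τ (1 - P) * B₀)) 0 := by
    have := ((ContinuousLinearMap.mul ℝ R (τ (1 - P) * B₀)).hasFDerivAt (x := (0 : R)))
    refine this.congr_of_eventuallyEq (Eventually.of_forall fun L => ?_)
    change τ (1 - P) * (B₀ : R) * (P + L) = τ (1 - P) * (B₀ : R) * L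
    rw [mul_add, h0, zero_add]
  have hm := (hf.mul' hg.hasFDerivAt).mul_const' (τ P)
  have hs := (τ.symm : R →L[ℝ] R).hasFDerivAt.comp (0 : R) hm
  refine hs.congr_fderiv ?_
  ext H
  change τ.symm ((τ (1 - P) * (B₀ : R) * (P + 0) * _ + τ (1 - P) * B₀ * H * Ring.inverse _) *
    τ P) = _
  rw [add_zero, h0, zero_mul, zero_add, graphDenom_base hP hPB, Ring.inverse_unit,
    linGraphTransform_apply]
  simp only [mul_assoc]

/-- A sufficiently small perturbation of `B₀` leaves invariant the graph of a small `L` over the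
range of `P`, as soon as the linearised graph transform is eventually contracting. -/
theorem eventually_exists_invariant_graph (hP : P * P = P) (hPB : τ P * B₀ = B₀ * P) {n : ℕ}
    (hK : ∀ H, ‖(linGraphTransform τ P B₀ ↑B₀⁻¹)^[n] H‖ ≤ 1 / 2 * ‖H‖) {V : Set R}
    (hV : V ∈ 𝓝 (0 : R)) :
    ∀ᶠ B in 𝓝 (B₀ : R), ∃ L ∈ V, (1 - P) * L * P = L ∧
      (∃ Y, B * (P + L) = τ (P + L) * Y) ∧ ∃ Y, B * (P + L) * Y = τ (P + L) := by
  -- the implicit function theorem is applied to the fixed point equation of the graph transform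
  set F : R × R → R := fun z => z.2 - graphTransform τ P (B₀ : R) z with hF
  have hFc : ContDiffAt ℝ 1 F ((B₀ : R), 0) :=
    contDiffAt_snd.sub (contDiffAt_graphTransform hP hPB)
  have hst := hFc.hasStrictFDerivAt (by simp)
  have hpart : (fderiv ℝ F ((B₀ : R), 0)) ∘L .inr ℝ R R =
      1 - linGraphTransform τ P B₀ ↑B₀⁻¹ := by
    have h1 : HasFDerivAt (fun L : R => F ((B₀ : R), L))
        ((fderiv ℝ F ((B₀ : R), 0)) ∘L .inr ℝ R R) 0 :=
      hst.hasFDerivAt.comp (0 : R) (hasFDerivAt_prodMk_right (B₀ : R) (0 : R))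
    have h2 : HasFDerivAt (fun L : R => F ((B₀ : R), L))
        (1 - linGraphTransform τ P B₀ ↑B₀⁻¹) 0 :=
      (hasFDerivAt_id (0 : R)).sub (hasFDerivAt_graphTransform hP hPB)
    exact h1.unique h2
  have hinv : ((fderiv ℝ F ((B₀ : R), 0)) ∘L .inr ℝ R R).IsInvertible := by
    rw [hpart]
    have hK' : ‖linGraphTransform τ P B₀ ↑B₀⁻¹ ^ n‖ < 1 := by
      refine lt_of_le_of_lt (ContinuousLinearMap.opNorm_le_bound _ (M := 1 / 2) (by norm_num)
        fun H => ?_) (by norm_num)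
      rw [FunLike.coe_pow_eq_iterate]
      exact hK H
    obtain ⟨u, hu⟩ := isUnit_one_sub_of_norm_pow_lt_one hK'
    exact ⟨ContinuousLinearEquiv.unitsEquiv ℝ R u, hu⟩
  have hF0 : F ((B₀ : R), 0) = 0 := by
    have h0 : τ (1 - P) * (B₀ : R) * P = 0 := by
      rw [map_sub, map_one, sub_mul, one_mul, hPB, sub_mul, mul_assoc, hP, sub_self]
    simp only [hF, graphTransform, add_zero, h0, zero_mul, map_zero, sub_zero]
  have hψ := hst.tendsto_implicitFunctionOfProdDomain hinv
  have hψ' := hst.eventually_apply_implicitFunctionOfProdDomain hinv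
  set ψ := hst.implicitFunctionOfProdDomain hinv
  have hD : ∀ᶠ B in 𝓝 (B₀ : R), IsUnit (graphDenom τ P (B₀ : R) (B, ψ B)) := by
    have hc : Continuous (graphDenom τ P (B₀ : R)) := by
      unfold graphDenom
      fun_prop
    have ht : Tendsto (fun B => graphDenom τ P (B₀ : R) (B, ψ B)) (𝓝 (B₀ : R))
        (𝓝 (B₀ : R)) := by
      have := (hc.tendsto ((B₀ : R), 0)).comp (tendsto_id.prodMk_nhds hψ)
      rwa [graphDenom_base hP hPB] at this
    exact ht.eventually (Units.nhds B₀)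
  filter_upwards [hψ', hD, hψ hV] with B hB hDB hVB
  refine ⟨ψ B, hVB, ?_⟩
  rw [hF0, hF, sub_eq_zero] at hB
  simp only at hB
  set L := ψ B
  obtain ⟨D, hDeq⟩ := hDB
  have hτP : τ P * τ P = τ P := by rw [← map_mul, hP]
  have hτQ : τ P * τ (1 - P) = 0 := by rw [← map_mul, mul_sub, mul_one, hP, sub_self, map_zero]
  have hτQ' : τ (1 - P) * τ (1 - P) = τ (1 - P) := by
    rw [← map_mul]; congr 1; simp [mul_sub, sub_mul, hP]
  -- the fixed point equation, transported by `τ`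
  have hL : τ L = τ (1 - P) * B * (P + L) * (↑D⁻¹ : R) * τ P := by
    conv_lhs => rw [hB]
    simp only [graphTransform, ← hDeq, Ring.inverse_unit]
    exact τ.apply_symm_apply _
  have hLP : L * P = L :=
    τ.injective (by change τ (L * P) = τ L; rw [map_mul, hL]; simp only [mul_assoc, hτP])
  have hQL : (1 - P) * L = L :=
    τ.injective (by change τ ((1 - P) * L) = τ L; rw [map_mul, hL]; simp only [← mul_assoc, hτQ'])
  have hDP : (D : R) * P = τ P * B * (P + L) := by
    rw [hDeq, graphDenom]
    simp only [add_mul, mul_assoc, hP, hLP, sub_mul, one_mul, sub_self, mul_zero, add_zero]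
  have hPD : τ P * (D : R) = D * P := by
    rw [hDP, hDeq, graphDenom]
    simp only [mul_add, ← mul_assoc, hτP, hτQ, zero_mul, add_zero]
  have hPD' : (↑D⁻¹ : R) * τ P = P * ↑D⁻¹ := by
    rw [Units.inv_mul_eq_iff_eq_mul, ← mul_assoc, ← hPD, mul_assoc, Units.mul_inv, mul_one]
  have key : B * (P + L) = τ (P + L) * (D * P) := by
    have e1 : τ L * (D * P) = τ (1 - P) * B * (P + L) := by
      rw [hL, mul_assoc (_ * _) _ (τ P), hPD']
      simp only [mul_assoc]
      rw [← mul_assoc (↑D⁻¹ : R) (D : R) P, Units.inv_mul, one_mul, hP, add_mul, hP, hLP]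
    have e2 : τ P * (D * P) = τ P * B * (P + L) := by
      rw [hDP]; simp only [← mul_assoc, hτP]
    rw [map_add, add_mul, e1, e2, map_sub, map_one]
    noncomm_ring
  refine ⟨by rw [hQL, hLP], ⟨_, key⟩, ↑D⁻¹ * τ P, ?_⟩
  rw [key, hPD']
  simp only [mul_assoc]
  rw [← mul_assoc P P, hP, ← hPD', ← mul_assoc (D : R), Units.mul_inv, one_mul, ← map_mul,
    add_mul, hP, hLP]

end BanachAlgebra

/-! ### Persistence of an invariant idempotent -/

section BanachAlgebra

variable {R : Type*} [NormedRing R] [NormedAlgebra ℝ R] [CompleteSpace R]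
  {τ : R ≃A[ℝ] R} {P : R} {B₀ : Rˣ}

/-- Persistence of an invariant idempotent. The graph transform of `B₀` over the range of `P`
moves the range, the one of the inverse over the range of `1 - P` moves the kernel, and both
together conjugate `P` to an idempotent intertwined by the perturbation of `B₀`. -/
theorem eventually_exists_conj_invariant (hP : P * P = P) (hPB : τ P * B₀ = B₀ * P) {n : ℕ}
    (hK : ∀ H, ‖(linGraphTransform τ P B₀ ↑B₀⁻¹)^[n] H‖ ≤ 1 / 2 * ‖H‖)
    (hK' : ∀ H, ‖(linGraphTransform τ.symm (1 - P) (τ.symm ↑B₀⁻¹) (τ.symm B₀))^[n] H‖ ≤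
      1 / 2 * ‖H‖)
    {V : Set R} (hV : V ∈ 𝓝 P) :
    ∀ᶠ B in 𝓝 (B₀ : R), ∃ S : Rˣ, S * P * ↑S⁻¹ ∈ V ∧
      τ (S * P * ↑S⁻¹) * B = B * (S * P * ↑S⁻¹) := by
  have hgood : ∀ᶠ s in 𝓝 (1 : R), IsUnit s ∧ s * P * Ring.inverse s ∈ V := by
    refine Filter.Eventually.and (Units.nhds (1 : Rˣ)) ?_
    have hc : ContinuousAt (fun s : R => s * P * Ring.inverse s) 1 := by
      have := NormedRing.inverse_continuousAt (1 : Rˣ)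
      exact (continuousAt_id.mul continuousAt_const).mul this
    exact hc (by simpa using hV)
  have hadd : Tendsto (fun z : R × R => 1 + z.1 + z.2) (𝓝 0 ×ˢ 𝓝 0) (𝓝 1) := by
    have : Continuous fun z : R × R => 1 + z.1 + z.2 := by fun_prop
    simpa [nhds_prod_eq] using this.tendsto ((0 : R), (0 : R))
  obtain ⟨V₁, hV₁, V₂, hV₂, hV₁₂⟩ := eventually_prod_iff.1 (hadd.eventually hgood)
  set C₀ : Rˣ := Units.map (τ.symm : R ≃A[ℝ] R).toAlgEquiv.toRingEquiv.toMonoidHom B₀⁻¹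
  have hC : (C₀ : R) = τ.symm ↑B₀⁻¹ := rfl
  have hC' : (↑C₀⁻¹ : R) = τ.symm B₀ := rfl
  have hP' : (1 - P) * (1 - P) = 1 - P := by simp [mul_sub, sub_mul, hP]
  have hPB' : τ.symm (1 - P) * C₀ = C₀ * (1 - P) := by
    apply τ.injective
    change τ (τ.symm (1 - P) * C₀) = τ (C₀ * (1 - P))
    rw [hC, map_mul, map_mul, τ.apply_symm_apply, τ.apply_symm_apply,
      Units.eq_inv_mul_iff_mul_eq, ← mul_assoc, ← Units.eq_mul_inv_iff_mul_eq, inv_inv, map_sub,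
      map_one, sub_mul, mul_sub, one_mul, mul_one, hPB]
  have hE := eventually_exists_invariant_graph hP hPB hK hV₁
  have hF := eventually_exists_invariant_graph (τ := τ.symm) (P := 1 - P) (B₀ := C₀) hP' hPB'
    (by rw [hC, hC']; exact hK') hV₂
  have hinv : Tendsto (fun B => τ.symm (Ring.inverse B)) (𝓝 (B₀ : R)) (𝓝 (C₀ : R)) := by
    rw [hC, ← Ring.inverse_unit B₀]
    exact (τ.symm.continuous.tendsto _).comp (NormedRing.inverse_continuousAt B₀)
  filter_upwards [hE, hinv.eventually hF, Units.nhds B₀] with B h1 h2 h3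
  obtain ⟨L, hLV, hL, ⟨Y, hY⟩, -⟩ := h1
  obtain ⟨M, hMV, hM, -, Z, hZ⟩ := h2
  obtain ⟨⟨S, hS⟩, hSV⟩ := hV₁₂ hLV hMV
  simp only at hS hSV
  rw [← hS, Ring.inverse_unit] at hSV
  have hLP : L * P = L := by rw [← hL]; simp only [mul_assoc, hP]
  have hMP : M * P = 0 := by rw [← hM]; simp [mul_assoc, sub_mul, hP]
  have hSP : (S : R) * P = P + L := by
    rw [hS, add_mul, add_mul, hLP, hMP, one_mul, add_zero]
  have hSQ : (S : R) * (1 - P) = 1 - P + M := by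
    rw [mul_sub, hSP, mul_one, hS]; abel
  set Q : R := S * P * ↑S⁻¹ with hQ
  have hQ' : 1 - Q = S * (1 - P) * ↑S⁻¹ := by
    rw [mul_sub, sub_mul, mul_one, Units.mul_inv]
  have e1 : τ Q * (B * Q) = B * Q := by
    have : B * Q = τ (S * P) * (Y * ↑S⁻¹) := by
      rw [hQ, hSP, ← mul_assoc, hY, mul_assoc]
    rw [this, ← mul_assoc, ← map_mul, hQ]
    congr 2
    rw [mul_assoc, ← mul_assoc (↑S⁻¹ : R), Units.inv_mul, one_mul, mul_assoc, hP]
  have e2 : τ (1 - Q) * (B * (1 - Q)) = B * (1 - Q) := by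
    have h5 : B * (S * (1 - P)) = τ (S * (1 - P)) * τ Z := by
      have h6 := congrArg τ hZ
      rw [map_mul, map_mul, τ.apply_symm_apply, τ.apply_symm_apply, ← hSQ] at h6
      conv_lhs => rw [← h6, mul_assoc (Ring.inverse B), ← mul_assoc B,
        Ring.mul_inverse_cancel _ h3, one_mul]
    have : B * (1 - Q) = τ (S * (1 - P)) * (τ Z * ↑S⁻¹) := by
      rw [hQ', ← mul_assoc, h5, mul_assoc]
    rw [this, ← mul_assoc, ← map_mul, hQ']
    congr 2
    rw [mul_assoc, ← mul_assoc (↑S⁻¹ : R), Units.inv_mul, one_mul, mul_assoc, hP']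
  -- invariance of the range and of the kernel of `Q` amounts to the intertwining relation
  refine ⟨S, hSV, ?_⟩
  rw [map_sub, map_one, sub_mul, one_mul, sub_eq_self, mul_sub, mul_one, mul_sub, e1,
    sub_eq_zero] at e2
  exact e2

end BanachAlgebra

/-! ### The action of matrices on the plane -/

section Plane

theorem act_mul (g h : GL (Fin 2) ℝ) : act (g * h) = act g * act h := by
  simp [act]

theorem act_one : act 1 = 1 := by
  simp [act]

theorem act_mul_inv (g : GL (Fin 2) ℝ) : act g * act g⁻¹ = 1 := by
  rw [← act_mul, mul_inv_cancel, act_one]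

theorem act_inv_mul (g : GL (Fin 2) ℝ) : act g⁻¹ * act g = 1 := by
  rw [← act_mul, inv_mul_cancel, act_one]

theorem act_inv_apply_act (g : GL (Fin 2) ℝ) (v : Plane) : act g⁻¹ (act g v) = v :=
  DFunLike.congr_fun (act_inv_mul g) v

theorem act_apply_ne_zero (g : GL (Fin 2) ℝ) {v : Plane} (hv : v ≠ 0) : act g v ≠ 0 :=
  fun h => hv (by rw [← act_inv_apply_act g v, h, map_zero])

theorem act_injective (g : GL (Fin 2) ℝ) : Function.Injective (act g) :=
  Function.LeftInverse.injective (act_inv_apply_act g)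

theorem continuous_act : Continuous act := by
  have h : Continuous (Matrix.toEuclideanCLM (n := Fin 2) (𝕜 := ℝ)) :=
    LinearMap.continuous_of_finiteDimensional
      (Matrix.toEuclideanCLM (n := Fin 2) (𝕜 := ℝ)).toAlgEquiv.toLinearMap
  exact h.comp Units.continuous_val

theorem rot_add (a b : ℝ) : rot (a + b) = rot a * rot b := by
  apply Units.ext
  ext i j
  fin_cases i <;> fin_cases j <;>
    simp [rot, Matrix.GeneralLinearGroup.mkOfDetNeZero, Real.cos_add, Real.sin_add,
      Matrix.mul_apply, Fin.sum_univ_two] <;> ring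

theorem rot_zero : rot 0 = 1 := by
  apply Units.ext
  ext i j
  fin_cases i <;> fin_cases j <;> simp [rot, Matrix.GeneralLinearGroup.mkOfDetNeZero]

theorem rot_inv (a : ℝ) : (rot a)⁻¹ = rot (-a) := by
  rw [inv_eq_iff_mul_eq_one, ← rot_add, add_neg_cancel, rot_zero]

theorem continuous_rot : Continuous rot := by
  have h : Continuous fun θ : ℝ => (rot θ : Matrix (Fin 2) (Fin 2) ℝ) := by
    refine continuous_matrix fun i j => ?_
    fin_cases i <;> fin_cases j <;>
      simp [rot, Matrix.GeneralLinearGroup.mkOfDetNeZero] <;> fun_prop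
  rw [Units.continuous_iff]
  refine ⟨h, ?_⟩
  have : (fun θ => ((rot θ)⁻¹ : GL (Fin 2) ℝ).val) = fun θ => (rot (-θ)).val := by
    funext θ; rw [rot_inv]
  change Continuous (fun θ => ((rot θ)⁻¹ : GL (Fin 2) ℝ).val)
  rw [this]
  exact h.comp continuous_neg

theorem rotated_rotated {X : Type*} (A : X → GL (Fin 2) ℝ) (a b : ℝ) :
    rotated (rotated A a) b = rotated A (a + b) := by
  funext x
  simp only [rotated]
  rw [rot_add, mul_assoc]

theorem rotated_zero {X : Type*} (A : X → GL (Fin 2) ℝ) : rotated A 0 = A := by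
  funext x
  simp only [rotated]
  rw [rot_zero, mul_one]

end Plane

/-! ### Iterates of a cocycle -/

section Iterates

variable {X : Type*} [TopologicalSpace X] {T : X ≃ₜ X} {A : X → GL (Fin 2) ℝ}

theorem iter_add (m n : ℕ) (x : X) :
    iter T A (m + n) x = iter T A m (T^[n] x) * iter T A n x := by
  induction m with
  | zero => simp [iter]
  | succ m ih =>
    rw [Nat.succ_add, iter, ih, iter, ← mul_assoc, ← Function.iterate_add_apply]

theorem iter_one (x : X) : iter T A 1 x = A x := by simp [iter]

theorem iter_succ' (n : ℕ) (x : X) : iter T A (n + 1) x = iter T A n (T x) * A x := by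
  rw [iter_add, iter_one]; rfl

/-- The inverse cocycle, over the inverse homeomorphism. -/
theorem backIter_eq_iter_symm (n : ℕ) (x : X) :
    backIter T A n x = iter T.symm (fun x => (A (T.symm x))⁻¹) n x := by
  induction n with
  | zero => rfl
  | succ n ih => rw [backIter, iter, ih, Function.iterate_succ_apply']

theorem backIter_iterate (n : ℕ) (x : X) :
    backIter T A n (T^[n] x) = (iter T A n x)⁻¹ := by
  induction n generalizing x with
  | zero => simp [backIter, iter]
  | succ n ih =>
    have h : T.symm^[n + 1] (T^[n + 1] x) = x :=
      Function.LeftInverse.iterate T.symm_apply_apply (n + 1) x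
    rw [backIter, h, iter_succ', mul_inv_rev, Function.iterate_succ_apply, ih]

theorem continuous_iter_rotated (T : X ≃ₜ X) (hA : Continuous A) (n : ℕ) :
    Continuous fun p : ℝ × X => iter T (rotated A p.1) n p.2 := by
  induction n with
  | zero => exact continuous_const
  | succ n ih =>
    have h1 : Continuous fun p : ℝ × X => A (T^[n] p.2) :=
      hA.comp ((T.continuous.iterate n).comp continuous_snd)
    exact (h1.mul (continuous_rot.comp continuous_fst)).mul ih

theorem continuous_rotated (hA : Continuous A) (θ : ℝ) : Continuous (rotated A θ) :=
  hA.mul continuous_const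

theorem continuous_iter (T : X ≃ₜ X) (hA : Continuous A) (n : ℕ) :
    Continuous (iter T A n) := by
  have := (continuous_iter_rotated T hA n).comp (Continuous.prodMk_right (0 : ℝ))
  simpa only [Function.comp_def, rotated_zero] using this

end Iterates

/-! ### Fields of projections and dominated splittings -/

section Splitting

/-- The Banach algebra of endomorphisms of the plane, with the operator norm. -/
abbrev PlaneEnd : Type := Plane →L[ℝ] Plane

theorem normOn_nonneg (g : GL (Fin 2) ℝ) (V : Submodule ℝ Plane) : 0 ≤ normOn g V := by
  unfold normOn
  positivity

theorem norm_act_le_normOn (g : GL (Fin 2) ℝ) {V : Submodule ℝ Plane} {v : Plane} (hv : v ∈ V) :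
    ‖act g v‖ ≤ normOn g V * ‖v‖ :=
  ((act g).comp V.subtypeL).le_opNorm ⟨v, hv⟩

theorem normOn_le (g : GL (Fin 2) ℝ) {V : Submodule ℝ Plane} {C : ℝ} (hC : 0 ≤ C)
    (h : ∀ v ∈ V, ‖act g v‖ ≤ C * ‖v‖) : normOn g V ≤ C :=
  ContinuousLinearMap.opNorm_le_bound _ hC fun v => h v v.2

theorem normOn_mul_le (g h : GL (Fin 2) ℝ) {V W : Submodule ℝ Plane}
    (hVW : ∀ v ∈ V, act h v ∈ W) : normOn (g * h) V ≤ normOn g W * normOn h V := by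
  refine normOn_le _ (mul_nonneg (normOn_nonneg _ _) (normOn_nonneg _ _)) fun v hv => ?_
  rw [act_mul, mul_assoc]
  exact (norm_act_le_normOn g (hVW v hv)).trans
    (mul_le_mul_of_nonneg_left (norm_act_le_normOn h hv) (normOn_nonneg _ _))

theorem norm_act_mul_le_normOn (g : GL (Fin 2) ℝ) {V : Submodule ℝ Plane} (p : PlaneEnd)
    (hp : ∀ v, p v ∈ V) : ‖act g * p‖ ≤ normOn g V * ‖p‖ := by
  refine ContinuousLinearMap.opNorm_le_bound _
    (mul_nonneg (normOn_nonneg _ _) (norm_nonneg _)) fun v => ?_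
  rw [mul_assoc]
  exact (norm_act_le_normOn g (hp v)).trans
    (mul_le_mul_of_nonneg_left (p.le_opNorm v) (normOn_nonneg _ _))

theorem normOn_range_le (g : GL (Fin 2) ℝ) {p : PlaneEnd} (hp : p * p = p) :
    normOn g (LinearMap.range (p : Plane →ₗ[ℝ] Plane)) ≤ ‖act g * p‖ := by
  refine normOn_le _ (norm_nonneg _) ?_
  rintro _ ⟨v, rfl⟩
  have h : p (p v) = p v := DFunLike.congr_fun hp v
  have := (act g * p).le_opNorm (p v)
  change ‖act g (p (p v))‖ ≤ _ at this
  rwa [h] at this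

theorem finrank_range_one_sub {p : PlaneEnd} (hp : p * p = p)
    (hr : Module.finrank ℝ (LinearMap.range (p : Plane →ₗ[ℝ] Plane)) = 1) :
    Module.finrank ℝ (LinearMap.range ((1 - p : PlaneEnd) : Plane →ₗ[ℝ] Plane)) = 1 := by
  have hi : IsIdempotentElem (p : Plane →ₗ[ℝ] Plane) :=
    LinearMap.ext fun v => DFunLike.congr_fun hp v
  have h1 := LinearMap.finrank_range_add_finrank_ker (p : Plane →ₗ[ℝ] Plane)
  have h2 : Module.finrank ℝ Plane = 2 := by simp
  have h3 := LinearMap.IsIdempotentElem.ker_eq_range_one_sub hi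
  rw [h3] at h1
  change _ + Module.finrank ℝ (LinearMap.range ((1 - p : PlaneEnd) : Plane →ₗ[ℝ] Plane)) = _ at h1
  omega

variable {X : Type*} [TopologicalSpace X]

/-- The cocycle generated by `A` over `T` is dominated along the continuous field `P` of rank one
projections: `P` is invariant, and after `n` steps the kernel of `P` is contracted relatively to
its range. The projection is the one onto the stronger line field along the weaker one. -/
structure IsDominatedAlong (T : X ≃ₜ X) (A : X → GL (Fin 2) ℝ) (P : C(X, PlaneEnd)) (n : ℕ) :
    Prop where
  idem : ∀ x, P x * P x = P x
  comm : ∀ x, P (T x) * act (A x) = act (A x) * P x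
  rank : ∀ x, Module.finrank ℝ (LinearMap.range (P x : Plane →ₗ[ℝ] Plane)) = 1
  pos : 1 ≤ n
  contr : ∀ x, ‖act (iter T A n x) * (1 - P x)‖ * ‖act (iter T A n x)⁻¹ * P (T^[n] x)‖ < 1 / 2

theorem isContinuousLineField_range {P : C(X, PlaneEnd)}
    (hr : ∀ x, Module.finrank ℝ (LinearMap.range (P x : Plane →ₗ[ℝ] Plane)) = 1) :
    IsContinuousLineField fun x => LinearMap.range (P x : Plane →ₗ[ℝ] Plane) := by
  intro x₀
  have hne : ∃ v, P x₀ v ≠ 0 := by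
    by_contra! h
    have : LinearMap.range (P x₀ : Plane →ₗ[ℝ] Plane) = ⊥ := by
      rw [LinearMap.range_eq_bot]; ext v : 1; exact h v
    have h1 := hr x₀
    rw [this, finrank_bot] at h1
    exact zero_ne_one h1
  obtain ⟨v, hv⟩ := hne
  have hc : Continuous fun x => P x v := P.continuous.clm_apply continuous_const
  refine ⟨{x | P x v ≠ 0}, (isOpen_ne_fun hc continuous_const).mem_nhds hv, fun x => P x v,
    hc.continuousOn, fun x hx => ⟨hx, ?_⟩⟩
  symm
  have hle : Submodule.span ℝ {P x v} ≤ LinearMap.range (P x : Plane →ₗ[ℝ] Plane) := by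
    rw [Submodule.span_singleton_le_iff_mem]; exact ⟨v, rfl⟩
  refine Submodule.eq_of_le_of_finrank_eq hle ?_
  rw [finrank_span_singleton hx, hr x]

section Projections

variable {T : X ≃ₜ X} {A : X → GL (Fin 2) ℝ} {P : C(X, PlaneEnd)} {n : ℕ}

theorem IsDominatedAlong.comm_iterate (h : IsDominatedAlong T A P n) (k : ℕ) (x : X) :
    P (T^[k] x) * act (iter T A k x) = act (iter T A k x) * P x := by
  induction k with
  | zero => simp [iter, act_one]
  | succ k ih =>
    rw [iter, act_mul, Function.iterate_succ_apply', ← mul_assoc, h.comm, mul_assoc, ih,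
      mul_assoc]

theorem IsDominatedAlong.comm_iterate_inv (h : IsDominatedAlong T A P n) (k : ℕ) (x : X) :
    P x * act (iter T A k x)⁻¹ = act (iter T A k x)⁻¹ * P (T^[k] x) := by
  calc P x * act (iter T A k x)⁻¹
      = act (iter T A k x)⁻¹ * (act (iter T A k x) * P x) * act (iter T A k x)⁻¹ := by
        rw [← mul_assoc, act_inv_mul, one_mul]
    _ = _ := by
        rw [← h.comm_iterate, mul_assoc, mul_assoc, act_mul_inv, mul_one]

/-- Exchanging the roles of the two line fields dominates the inverse cocycle. -/
theorem IsDominatedAlong.symm (h : IsDominatedAlong T A P n) :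
    IsDominatedAlong T.symm (fun x => (A (T.symm x))⁻¹) (1 - P) n where
  idem x := by
    change (1 - P x) * (1 - P x) = 1 - P x
    simp [mul_sub, sub_mul, h.idem]
  comm x := by
    change (1 - P (T.symm x)) * act (A (T.symm x))⁻¹ = act (A (T.symm x))⁻¹ * (1 - P x)
    have := h.comm_iterate_inv 1 (T.symm x)
    rw [iter_one] at this
    simp only [Function.iterate_one, T.apply_symm_apply] at this
    rw [sub_mul, mul_sub, this, one_mul, mul_one]
  rank x := finrank_range_one_sub (h.idem x) (h.rank x)
  pos := h.pos
  contr x := by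
    obtain ⟨y, rfl⟩ := (T.surjective.iterate n) x
    have hy : T.symm^[n] (T^[n] y) = y :=
      Function.LeftInverse.iterate T.symm_apply_apply n y
    rw [← backIter_eq_iter_symm, backIter_iterate, inv_inv, hy, mul_comm]
    change ‖act (iter T A n y) * (1 - P y)‖ *
      ‖act (iter T A n y)⁻¹ * (1 - (1 - P (T^[n] y)))‖ < _
    rw [sub_sub_cancel]
    exact h.contr y

theorem IsDominatedAlong.map_range (h : IsDominatedAlong T A P n) (x : X) :
    (LinearMap.range (P x : Plane →ₗ[ℝ] Plane)).map (act (A x)).toLinearMap =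
      LinearMap.range (P (T x) : Plane →ₗ[ℝ] Plane) := by
  refine Submodule.eq_of_le_of_finrank_eq ?_ ?_
  · rintro _ ⟨_, ⟨v, rfl⟩, rfl⟩
    exact ⟨act (A x) v, DFunLike.congr_fun (h.comm x) v⟩
  · rw [h.rank, ← h.rank x]
    exact (Submodule.equivMapOfInjective _ (act_injective (A x)) _).finrank_eq.symm

theorem IsDominatedAlong.map_range_one_sub (h : IsDominatedAlong T A P n) (x : X) :
    (LinearMap.range ((1 - P x : PlaneEnd) : Plane →ₗ[ℝ] Plane)).map (act (A x)).toLinearMap =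
      LinearMap.range ((1 - P (T x) : PlaneEnd) : Plane →ₗ[ℝ] Plane) := by
  refine Submodule.eq_of_le_of_finrank_eq ?_ ?_
  · rintro _ ⟨_, ⟨v, rfl⟩, rfl⟩
    have hc : (1 - P (T x)) * act (A x) = act (A x) * (1 - P x) := by
      rw [sub_mul, mul_sub, h.comm, one_mul, mul_one]
    exact ⟨act (A x) v, DFunLike.congr_fun hc v⟩
  · rw [finrank_range_one_sub (h.idem _) (h.rank _),
      ← finrank_range_one_sub (h.idem x) (h.rank x)]
    exact (Submodule.equivMapOfInjective _ (act_injective (A x)) _).finrank_eq.symm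

/-- The range of `P` is the strong line field `F`, and the kernel of `P` the weak one `E`. -/
theorem IsDominatedAlong.hasDominatedSplitting (h : IsDominatedAlong T A P n) :
    HasDominatedSplitting T A := by
  refine ⟨fun x => LinearMap.range ((1 - P x : PlaneEnd) : Plane →ₗ[ℝ] Plane),
    fun x => LinearMap.range (P x : Plane →ₗ[ℝ] Plane),
    by simpa only [ContinuousMap.sub_apply, ContinuousMap.one_apply] using
      isContinuousLineField_range h.symm.rank,
    isContinuousLineField_range h.rank, fun x => ?_,
    fun x => ⟨finrank_range_one_sub (h.idem x) (h.rank x), h.rank x⟩,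
    fun x => ⟨h.map_range_one_sub x, h.map_range x⟩, n, h.pos, fun x => ?_⟩
  · have hi : IsIdempotentElem (P x : Plane →ₗ[ℝ] Plane) :=
      LinearMap.ext fun v => DFunLike.congr_fun (h.idem x) v
    have := LinearMap.IsIdempotentElem.isCompl hi
    rw [LinearMap.IsIdempotentElem.ker_eq_range_one_sub hi] at this
    exact this.symm
  · rw [backIter_iterate]
    have hi : (1 - P x) * (1 - P x) = 1 - P x := by simp [mul_sub, sub_mul, h.idem]
    exact (mul_le_mul (normOn_range_le _ hi) (normOn_range_le _ (h.idem _))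
      (normOn_nonneg _ _) (norm_nonneg _)).trans_lt (h.contr x)

end Projections

end Splitting

/-! ### The field of projections of a dominated splitting -/

section SplittingToProjection

variable {X : Type*} [TopologicalSpace X]

/-- The area form of the plane. -/
def area (a b : Plane) : ℝ := a 0 * b 1 - a 1 * b 0

theorem area_smul_add_area_smul (u v w : Plane) :
    area u w • v + area w v • u = area u v • w := by
  ext i
  fin_cases i <;> simp [area] <;> ring

theorem area_ne_zero {u v : Plane} (hu : u ≠ 0) (hv : v ≠ 0)
    (h : Disjoint (Submodule.span ℝ {u}) (Submodule.span ℝ {v})) : area u v ≠ 0 := by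
  intro h0
  have hdep : ∀ w : Plane, area u w • v = -(area w v • u) := fun w => by
    rw [eq_neg_iff_add_eq_zero, area_smul_add_area_smul, h0, zero_smul]
  have hzero : ∀ w : Plane, area u w = 0 := fun w => by
    have hm : area u w • v ∈ Submodule.span ℝ {u} := by
      rw [hdep, Submodule.neg_mem_iff]
      exact Submodule.smul_mem _ _ (Submodule.mem_span_singleton_self u)
    have := (Submodule.disjoint_def.1 h) _ hm
      (Submodule.smul_mem _ _ (Submodule.mem_span_singleton_self v))
    exact (smul_eq_zero.1 this).resolve_right hv
  apply hu
  ext i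
  fin_cases i
  · simpa [area] using hzero (EuclideanSpace.single 1 1)
  · simpa [area] using hzero (EuclideanSpace.single 0 1)

/-- The projection onto the second of two transversal continuous line fields is continuous. -/
theorem continuous_projection {E F : X → Submodule ℝ Plane} (hE : IsContinuousLineField E)
    (hF : IsContinuousLineField F) (hEF : ∀ x, IsCompl (E x) (F x)) :
    Continuous fun x =>
      (LinearMap.toContinuousLinearMap ((F x).projection (E x) (hEF x).symm) : PlaneEnd) := by
  rw [continuous_clm_apply]
  intro w
  rw [continuous_iff_continuousAt]
  intro x₀
  obtain ⟨V, hV, u, hu, hu'⟩ := hE x₀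
  obtain ⟨W, hW, v, hv, hv'⟩ := hF x₀
  have hne : ∀ x ∈ V ∩ W, area (u x) (v x) ≠ 0 := fun x hx => by
    refine area_ne_zero (hu' x hx.1).1 (hv' x hx.2).1 ?_
    rw [← (hu' x hx.1).2, ← (hv' x hx.2).2]
    exact (hEF x).disjoint
  have hform : ∀ x ∈ V ∩ W, (F x).projection (E x) (hEF x).symm w =
      (area (u x) w / area (u x) (v x)) • v x := fun x hx => by
    have hdec : w = (area (u x) w / area (u x) (v x)) • v x +
        (area w (v x) / area (u x) (v x)) • u x := by
      rw [div_eq_inv_mul, div_eq_inv_mul, mul_smul, mul_smul, ← smul_add,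
        area_smul_add_area_smul, inv_smul_smul₀ (hne x hx)]
    have hvF : v x ∈ F x := by
      rw [(hv' x hx.2).2]; exact Submodule.mem_span_singleton_self _
    have huE : u x ∈ E x := by
      rw [(hu' x hx.1).2]; exact Submodule.mem_span_singleton_self _
    conv_lhs => rw [hdec, map_add, map_smul, map_smul]
    rw [Submodule.projection_apply_of_mem_left _ hvF,
      (Submodule.projection_apply_eq_zero_iff _).2 huE, smul_zero, add_zero]
  have hu0 : ContinuousAt u x₀ := hu.continuousAt hV
  have hv0 : ContinuousAt v x₀ := hv.continuousAt hW
  have hc : ContinuousAt (fun x => (area (u x) w / area (u x) (v x)) • v x) x₀ := by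
    have h1 : ContinuousAt (fun x => area (u x) w) x₀ := by unfold area; fun_prop
    have h2 : ContinuousAt (fun x => area (u x) (v x)) x₀ := by unfold area; fun_prop
    exact (h1.div h2 (hne x₀ ⟨mem_of_mem_nhds hV, mem_of_mem_nhds hW⟩)).smul hv0
  refine hc.congr ?_
  filter_upwards [inter_mem hV hW] with x hx
  exact (hform x hx).symm

/-- A dominated splitting provides a field of projections onto the strong line field along the weak
one. The norms of the projections are absorbed by taking a multiple of the number of steps. -/
theorem exists_isDominatedAlong [CompactSpace X] {T : X ≃ₜ X} {A : X → GL (Fin 2) ℝ}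
    (h : HasDominatedSplitting T A) :
    ∃ (P : C(X, PlaneEnd)) (n : ℕ), IsDominatedAlong T A P n := by
  obtain ⟨E, F, hE, hF, hEF, hr, hinv, l, hl, hdom⟩ := h
  set P : C(X, PlaneEnd) := ⟨_, continuous_projection hE hF hEF⟩ with hPdef
  have hPmem : ∀ x v, P x v ∈ F x := fun x v => Submodule.projection_apply_mem (hEF x).symm v
  have hPF : ∀ x, ∀ v ∈ F x, P x v = v := fun x v hv =>
    Submodule.projection_apply_of_mem_left (hEF x).symm hv
  have hPE : ∀ x, ∀ v ∈ E x, P x v = 0 := fun x v hv =>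
    (Submodule.projection_apply_eq_zero_iff (hEF x).symm).2 hv
  have hPrange : ∀ x, LinearMap.range (P x : Plane →ₗ[ℝ] Plane) = F x := fun x =>
    Submodule.range_projection (hEF x).symm
  have hQmem : ∀ x v, (1 - P x) v ∈ E x := fun x v => by
    rw [← Submodule.projection_apply_eq_zero_iff (hEF x).symm]
    change P x (v - P x v) = 0
    rw [map_sub, hPF x _ (hPmem x v), sub_self]
  have hEinv : ∀ m x, (E x).map (act (iter T A m x)).toLinearMap = E (T^[m] x) := by
    intro m x
    induction m with
    | zero => rw [iter, act_one]; exact Submodule.map_id _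
    | succ m ih =>
      rw [iter, act_mul, Function.iterate_succ_apply', ← (hinv _).1, ← ih, ← Submodule.map_comp]
      rfl
  have hFinv : ∀ m x, (F x).map (act (iter T A m x)).toLinearMap = F (T^[m] x) := by
    intro m x
    induction m with
    | zero => rw [iter, act_one]; exact Submodule.map_id _
    | succ m ih =>
      rw [iter, act_mul, Function.iterate_succ_apply', ← (hinv _).2, ← ih, ← Submodule.map_comp]
      rfl
  have hFinv' : ∀ m x, ∀ v ∈ F (T^[m] x), act (iter T A m x)⁻¹ v ∈ F x := by
    intro m x v hv
    rw [← hFinv m x] at hv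
    obtain ⟨w, hw, rfl⟩ := hv
    change act (iter T A m x)⁻¹ (act (iter T A m x) w) ∈ F x
    rwa [act_inv_apply_act]
  have hpow : ∀ (k : ℕ) x, normOn (iter T A (k * l) x) (E x) *
      normOn (iter T A (k * l) x)⁻¹ (F (T^[k * l] x)) ≤ (1 / 2) ^ k := by
    intro k
    induction k with
    | zero =>
      intro x
      have h1 : ∀ V : Submodule ℝ Plane, normOn 1 V ≤ 1 := fun V =>
        normOn_le _ zero_le_one fun v _ => by rw [act_one, one_mul]; rfl
      rw [zero_mul, iter, inv_one, pow_zero]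
      exact mul_le_one₀ (h1 _) (normOn_nonneg _ _) (h1 _)
    | succ k ih =>
      intro x
      have h1 := hdom x
      rw [backIter_iterate] at h1
      have h2 := ih (T^[l] x)
      rw [← Function.iterate_add_apply, ← Nat.succ_mul] at h2
      have h3 : normOn (iter T A ((k + 1) * l) x) (E x) ≤
          normOn (iter T A (k * l) (T^[l] x)) (E (T^[l] x)) * normOn (iter T A l x) (E x) := by
        rw [Nat.succ_mul, iter_add]
        refine normOn_mul_le _ _ fun v hv => ?_
        rw [← hEinv l x]
        exact ⟨v, hv, rfl⟩
      have h4 : normOn (iter T A ((k + 1) * l) x)⁻¹ (F (T^[(k + 1) * l] x)) ≤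
          normOn (iter T A l x)⁻¹ (F (T^[l] x)) *
            normOn (iter T A (k * l) (T^[l] x))⁻¹ (F (T^[(k + 1) * l] x)) := by
        rw [Nat.succ_mul, iter_add, mul_inv_rev]
        refine normOn_mul_le _ _ fun v hv => ?_
        rw [Function.iterate_add_apply] at hv
        exact hFinv' _ _ v hv
      calc _ ≤ _ := mul_le_mul h3 h4 (normOn_nonneg _ _)
            (mul_nonneg (normOn_nonneg _ _) (normOn_nonneg _ _))
        _ = (normOn (iter T A (k * l) (T^[l] x)) (E (T^[l] x)) *
              normOn (iter T A (k * l) (T^[l] x))⁻¹ (F (T^[(k + 1) * l] x))) *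
            (normOn (iter T A l x) (E x) * normOn (iter T A l x)⁻¹ (F (T^[l] x))) := by ring
        _ ≤ (1 / 2) ^ k * (1 / 2) := mul_le_mul h2 h1.le
            (mul_nonneg (normOn_nonneg _ _) (normOn_nonneg _ _)) (by positivity)
        _ = (1 / 2) ^ (k + 1) := by rw [pow_succ]
  -- the number of blocks compensates for the norms of the projections
  obtain ⟨k, hk1, hk⟩ : ∃ k : ℕ, 1 ≤ k ∧ (1 / 2 : ℝ) ^ k * (‖1 - P‖ * ‖P‖) < 1 / 2 := by
    have ht : Tendsto (fun k : ℕ => (1 / 2 : ℝ) ^ k * (‖1 - P‖ * ‖P‖)) atTop (𝓝 0) := by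
      simpa using (tendsto_pow_atTop_nhds_zero_of_lt_one (r := (1 / 2 : ℝ)) (by norm_num)
        (by norm_num)).mul_const (‖1 - P‖ * ‖P‖)
    exact ((eventually_ge_atTop 1).and
      (ht.eventually_lt_const (by norm_num : (0 : ℝ) < 1 / 2))).exists
  refine ⟨P, k * l, ⟨fun x => ?_, fun x => ?_, fun x => ?_, Nat.mul_pos hk1 hl, fun x => ?_⟩⟩
  · ext1 v
    exact hPF x _ (hPmem x v)
  · ext1 v
    have hA1 : act (A x) (P x v) ∈ F (T x) := by
      rw [← (hinv x).2]; exact ⟨_, hPmem x v, rfl⟩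
    have hA2 : act (A x) ((1 - P x) v) ∈ E (T x) := by
      rw [← (hinv x).1]; exact ⟨_, hQmem x v, rfl⟩
    have hv : v = P x v + (1 - P x) v := by
      change v = P x v + (v - P x v); abel
    change P (T x) (act (A x) v) = act (A x) (P x v)
    conv_lhs => rw [hv, map_add, map_add, hPF _ _ hA1, hPE _ _ hA2, add_zero]
  · rw [hPrange]; exact (hr x).2
  · calc _ ≤ (normOn (iter T A (k * l) x) (E x) * ‖1 - P x‖) *
          (normOn (iter T A (k * l) x)⁻¹ (F (T^[k * l] x)) * ‖P (T^[k * l] x)‖) :=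
          mul_le_mul (norm_act_mul_le_normOn _ _ (hQmem x)) (norm_act_mul_le_normOn _ _
            (hPmem _)) (norm_nonneg _) (mul_nonneg (normOn_nonneg _ _) (norm_nonneg _))
      _ = (normOn (iter T A (k * l) x) (E x) *
          normOn (iter T A (k * l) x)⁻¹ (F (T^[k * l] x))) * (‖1 - P x‖ * ‖P (T^[k * l] x)‖) := by
          ring
      _ ≤ (1 / 2) ^ k * (‖1 - P‖ * ‖P‖) := by
          refine mul_le_mul (hpow k x) (mul_le_mul ((1 - P).norm_coe_le_norm x)
            (P.norm_coe_le_norm _) (norm_nonneg _) (by positivity))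
            (mul_nonneg (norm_nonneg _) (norm_nonneg _)) (by positivity)
      _ < 1 / 2 := hk

end SplittingToProjection

/-! ### Persistence of domination under rotation -/

section Perturbation

variable {X : Type*} [TopologicalSpace X]

/-- Composition with `T`, as an automorphism of the algebra of continuous fields of
endomorphisms of the plane. -/
noncomputable def compAlgEquiv (T : X ≃ₜ X) : C(X, PlaneEnd) ≃A[ℝ] C(X, PlaneEnd) where
  toFun f := f.comp (T : C(X, X))
  invFun f := f.comp (T.symm : C(X, X))
  left_inv f := by ext1 x; exact congrArg f (T.apply_symm_apply x)
  right_inv f := by ext1 x; exact congrArg f (T.symm_apply_apply x)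
  map_mul' _ _ := rfl
  map_add' _ _ := rfl
  commutes' _ := rfl
  continuous_toFun := ContinuousMap.continuous_precomp _
  continuous_invFun := ContinuousMap.continuous_precomp _

theorem compAlgEquiv_symm_apply (T : X ≃ₜ X) (f : C(X, PlaneEnd)) (x : X) :
    (compAlgEquiv T).symm f x = f (T.symm x) := rfl

/-- A continuous matrix field as a unit of the algebra of continuous fields of endomorphisms. -/
noncomputable def actUnit (A : X → GL (Fin 2) ℝ) (hA : Continuous A) : C(X, PlaneEnd)ˣ where
  val := ⟨fun x => act (A x), continuous_act.comp hA⟩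
  inv := ⟨fun x => act (A x)⁻¹, continuous_act.comp hA.inv⟩
  val_inv := by ext1 x; exact act_mul_inv _
  inv_val := by ext1 x; exact act_inv_mul _

theorem isIdempotentElem_conj {M : Type*} [Monoid M] (s : Mˣ) {p : M} (hp : p * p = p) :
    (s * p * ↑s⁻¹) * (s * p * ↑s⁻¹) = s * p * ↑s⁻¹ := by
  calc (s * p * ↑s⁻¹) * (s * p * ↑s⁻¹) = s * (p * (↑s⁻¹ * s) * p) * ↑s⁻¹ := by
        simp only [mul_assoc]
    _ = _ := by rw [Units.inv_mul, mul_one, hp]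

theorem finrank_range_conj {p s t : PlaneEnd} (hts : t * s = 1)
    (hr : Module.finrank ℝ (LinearMap.range (p : Plane →ₗ[ℝ] Plane)) = 1) :
    Module.finrank ℝ (LinearMap.range ((s * p * t : PlaneEnd) : Plane →ₗ[ℝ] Plane)) = 1 := by
  have hs : Function.Injective (s : Plane →ₗ[ℝ] Plane) :=
    Function.LeftInverse.injective (g := t) fun v => DFunLike.congr_fun hts v
  have : LinearMap.range ((s * p * t : PlaneEnd) : Plane →ₗ[ℝ] Plane) =
      (LinearMap.range (p : Plane →ₗ[ℝ] Plane)).map (s : Plane →ₗ[ℝ] Plane) := by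
    ext v
    constructor
    · rintro ⟨w, rfl⟩
      exact ⟨p (t w), ⟨t w, rfl⟩, rfl⟩
    · rintro ⟨_, ⟨w, rfl⟩, rfl⟩
      refine ⟨s w, ?_⟩
      have : t (s w) = w := DFunLike.congr_fun hts w
      change s (p (t (s w))) = s (p w)
      rw [this]
  rw [this, ← hr]
  exact (Submodule.equivMapOfInjective _ hs _).finrank_eq.symm

variable {T : X ≃ₜ X} {A : X → GL (Fin 2) ℝ} {P : C(X, PlaneEnd)} {n : ℕ}

theorem IsDominatedAlong.comm_one_sub (h : IsDominatedAlong T A P n) (x : X) :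
    (1 - P (T x)) * act (A x) = act (A x) * (1 - P x) := by
  rw [sub_mul, mul_sub, h.comm, one_mul, mul_one]

theorem IsDominatedAlong.comm_inv (h : IsDominatedAlong T A P n) (x : X) :
    act (A x)⁻¹ * P (T x) = P x * act (A x)⁻¹ := by
  simpa [iter_one] using (h.comm_iterate_inv 1 x).symm

theorem continuous_actUnit_rotated (hA : Continuous A) :
    Continuous fun θ : ℝ => (actUnit (rotated A θ) (continuous_rotated hA θ) : C(X, PlaneEnd)) := by
  have hc : Continuous fun p : ℝ × X => act (rotated A p.1 p.2) :=
    continuous_act.comp ((hA.comp continuous_snd).mul (continuous_rot.comp continuous_fst))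
  exact (ContinuousMap.curry (⟨_, hc⟩ : C(ℝ × X, PlaneEnd))).continuous

variable [CompactSpace X]

theorem linGraphTransform_apply_apply (h : IsDominatedAlong T A P n) (hA : Continuous A)
    (H : C(X, PlaneEnd)) (x : X) :
    linGraphTransform (compAlgEquiv T) P (actUnit A hA) ↑(actUnit A hA)⁻¹ H (T x) =
      act (A x) * ((1 - P x) * H x * P x) * act (A x)⁻¹ := by
  rw [linGraphTransform_apply, compAlgEquiv_symm_apply, T.symm_apply_apply]
  change (1 - P (T x)) * act (A x) * (H x * (act (A x)⁻¹ * P (T x))) = _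
  rw [h.comm_one_sub, h.comm_inv]
  simp only [mul_assoc]

/-- The iterates of the linearised graph transform act by conjugation by the iterates of the
cocycle. -/
theorem linGraphTransform_iterate_apply (h : IsDominatedAlong T A P n) (hA : Continuous A)
    (H : C(X, PlaneEnd)) (k : ℕ) (x : X) :
    (linGraphTransform (compAlgEquiv T) P (actUnit A hA) ↑(actUnit A hA)⁻¹)^[k + 1] H
      (T^[k + 1] x) =
      act (iter T A (k + 1) x) * ((1 - P x) * H x * P x) * act (iter T A (k + 1) x)⁻¹ := by
  have hQ : ∀ y, (1 - P y) * (1 - P y) = 1 - P y := fun y => by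
    simp [mul_sub, sub_mul, h.idem]
  induction k with
  | zero => simpa [iter_one] using linGraphTransform_apply_apply h hA H x
  | succ k ih =>
    rw [Function.iterate_succ_apply', Function.iterate_succ_apply' T,
      linGraphTransform_apply_apply h hA, ih]
    have e1 : (1 - P (T^[k + 1] x)) * act (iter T A (k + 1) x) =
        act (iter T A (k + 1) x) * (1 - P x) := by
      rw [sub_mul, mul_sub, h.comm_iterate, one_mul, mul_one]
    have e2 := h.comm_iterate_inv (k + 1) x
    have e3 : (1 - P (T^[k + 1] x)) * (act (iter T A (k + 1) x) * ((1 - P x) * H x * P x) *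
        act (iter T A (k + 1) x)⁻¹) * P (T^[k + 1] x) =
        act (iter T A (k + 1) x) * ((1 - P x) * H x * P x) * act (iter T A (k + 1) x)⁻¹ := by
      calc _ = ((1 - P (T^[k + 1] x)) * act (iter T A (k + 1) x)) * ((1 - P x) * H x * P x) *
            (act (iter T A (k + 1) x)⁻¹ * P (T^[k + 1] x)) := by simp only [mul_assoc]
        _ = act (iter T A (k + 1) x) * ((1 - P x) * (1 - P x) * H x * (P x * P x)) *
            act (iter T A (k + 1) x)⁻¹ := by rw [e1, ← e2]; simp only [mul_assoc]
        _ = _ := by rw [hQ, h.idem]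
    have e4 : iter T A (k + 1 + 1) x = A (T^[k + 1] x) * iter T A (k + 1) x := rfl
    rw [e3, e4, mul_inv_rev, act_mul, act_mul]
    simp only [mul_assoc]

theorem norm_linGraphTransform_iterate_le (h : IsDominatedAlong T A P n)
    (hA : Continuous A) (H : C(X, PlaneEnd)) :
    ‖(linGraphTransform (compAlgEquiv T) P (actUnit A hA) ↑(actUnit A hA)⁻¹)^[n] H‖ ≤
      1 / 2 * ‖H‖ := by
  rw [ContinuousMap.norm_le _ (by positivity)]
  intro y
  obtain ⟨x, rfl⟩ := (T.surjective.iterate n) y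
  obtain ⟨k, hk⟩ := Nat.exists_eq_add_of_le' h.pos
  have hform := linGraphTransform_iterate_apply h hA H k x
  rw [← hk] at hform
  rw [hform]
  calc _ = ‖(act (iter T A n x) * (1 - P x)) * H x *
          (act (iter T A n x)⁻¹ * P (T^[n] x))‖ := by
        rw [← h.comm_iterate_inv]; simp only [mul_assoc]
    _ ≤ ‖act (iter T A n x) * (1 - P x)‖ * ‖H x‖ * ‖act (iter T A n x)⁻¹ * P (T^[n] x)‖ :=
        (norm_mul_le _ _).trans
          (mul_le_mul_of_nonneg_right (norm_mul_le _ _) (norm_nonneg _))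
    _ = (‖act (iter T A n x) * (1 - P x)‖ * ‖act (iter T A n x)⁻¹ * P (T^[n] x)‖) * ‖H x‖ := by
        ring
    _ ≤ 1 / 2 * ‖H‖ := mul_le_mul (h.contr x).le (H.norm_coe_le_norm x) (norm_nonneg _)
        (by norm_num)

/-- The linearised graph transform of the inverse cocycle, which moves the weak line field. -/
theorem norm_linGraphTransform_symm_iterate_le (h : IsDominatedAlong T A P n)
    (hA : Continuous A) (H : C(X, PlaneEnd)) :
    ‖(linGraphTransform (compAlgEquiv T).symm (1 - P) ((compAlgEquiv T).symm ↑(actUnit A hA)⁻¹)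
      ((compAlgEquiv T).symm (actUnit A hA)))^[n] H‖ ≤ 1 / 2 * ‖H‖ := by
  have hA' : Continuous fun x => (A (T.symm x))⁻¹ := (hA.comp T.symm.continuous).inv
  have e : ((compAlgEquiv T).symm (actUnit A hA) : C(X, PlaneEnd)) =
      ↑(actUnit _ hA')⁻¹ := by
    ext1 x
    change act (A (T.symm x)) = act ((A (T.symm x))⁻¹)⁻¹
    rw [inv_inv]
  rw [e]
  exact norm_linGraphTransform_iterate_le h.symm hA' H

/-- Domination in a given number of steps is an open condition on the angle and the projections,
by compactness of `X`. -/
theorem eventually_contr [T2Space X] (hA : Continuous A) (h : IsDominatedAlong T A P n) :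
    ∀ᶠ z : ℝ × C(X, PlaneEnd) in 𝓝 ((0 : ℝ), P),
      ∀ x, ‖act (iter T (rotated A z.1) n x) * (1 - z.2 x)‖ *
        ‖act (iter T (rotated A z.1) n x)⁻¹ * z.2 (T^[n] x)‖ < 1 / 2 := by
  have h1 : Continuous fun p : (ℝ × C(X, PlaneEnd)) × X => iter T (rotated A p.1.1) n p.2 :=
    (continuous_iter_rotated T hA n).comp
      (g := fun p : ℝ × X => iter T (rotated A p.1) n p.2)
      (f := fun p : (ℝ × C(X, PlaneEnd)) × X => (p.1.1, p.2))
      ((continuous_fst.comp continuous_fst).prodMk continuous_snd)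
  have h2 : Continuous fun p : (ℝ × C(X, PlaneEnd)) × X => p.1.2 p.2 := by fun_prop
  have h3 : Continuous fun p : (ℝ × C(X, PlaneEnd)) × X => p.1.2 (T^[n] p.2) := by
    have := T.continuous.iterate n
    fun_prop
  have hc : Continuous fun p : (ℝ × C(X, PlaneEnd)) × X =>
      ‖act (iter T (rotated A p.1.1) n p.2) * (1 - p.1.2 p.2)‖ *
        ‖act (iter T (rotated A p.1.1) n p.2)⁻¹ * p.1.2 (T^[n] p.2)‖ :=
    ((continuous_act.comp h1).mul (continuous_const.sub h2)).norm.mul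
      ((continuous_act.comp h1.inv).mul h3).norm
  set Φ := ContinuousMap.curry (⟨_, hc⟩ : C((ℝ × C(X, PlaneEnd)) × X, ℝ))
  have hmem : Φ (0, P) ∈ {f : C(X, ℝ) | Set.range f ⊆ Set.Iio (1 / 2)} := by
    rintro _ ⟨x, rfl⟩
    have := h.contr x
    rw [← rotated_zero A] at this
    exact this
  have := Φ.continuous.continuousAt.eventually
    ((ContinuousMap.isOpen_setOfPred_range_subset isOpen_Iio).mem_nhds hmem)
  filter_upwards [this] with z hz x
  exact hz ⟨x, rfl⟩

/-- Dominated splittings persist under rotation of the cocycle by a small angle, with the same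
number of steps and with nearby projections. -/
theorem IsDominatedAlong.eventually_rotated [T2Space X] (hA : Continuous A)
    (h : IsDominatedAlong T A P n) {V : Set C(X, PlaneEnd)} (hV : V ∈ 𝓝 P) :
    ∀ᶠ θ in 𝓝 (0 : ℝ), ∃ Q ∈ V, IsDominatedAlong T (rotated A θ) Q n := by
  have hev := eventually_contr hA h
  rw [nhds_prod_eq] at hev
  obtain ⟨p₁, hp₁, p₂, hp₂, hp⟩ := eventually_prod_iff.1 hev
  have hP : P * P = P := by ext1 x; exact h.idem x
  have hPB : compAlgEquiv T P * actUnit A hA = actUnit A hA * P := by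
    ext1 x; exact h.comm x
  have hconj := eventually_exists_conj_invariant (V := V ∩ {Q | p₂ Q}) hP hPB
    (norm_linGraphTransform_iterate_le h hA) (norm_linGraphTransform_symm_iterate_le h hA)
    (inter_mem hV hp₂)
  have ht : Tendsto (fun θ : ℝ =>
      (actUnit (rotated A θ) (continuous_rotated hA θ) : C(X, PlaneEnd))) (𝓝 0)
      (𝓝 (actUnit A hA : C(X, PlaneEnd))) := by
    have := (continuous_actUnit_rotated hA).tendsto 0
    simpa only [rotated_zero] using this
  filter_upwards [ht.eventually hconj, hp₁] with θ hθ hθ₁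
  obtain ⟨S, ⟨hSV, hSp⟩, hS⟩ := hθ
  refine ⟨_, hSV, ⟨fun x => ?_, fun x => DFunLike.congr_fun hS x, fun x => ?_, h.pos,
    hp hθ₁ hSp⟩⟩
  · exact DFunLike.congr_fun (isIdempotentElem_conj S hP) x
  · exact finrank_range_conj (DFunLike.congr_fun S.inv_mul x)
      (h.rank x)

end Perturbation

/-! ### Stretching of the strong line -/

section Stretch

theorem exists_ne_zero_mem_range {p : PlaneEnd}
    (hr : Module.finrank ℝ (LinearMap.range (p : Plane →ₗ[ℝ] Plane)) = 1) :
    ∃ v, p v ≠ 0 ∧ ∀ w, ∃ c : ℝ, p w = c • p v := by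
  obtain ⟨⟨_, v, rfl⟩, hv0, hv⟩ := finrank_eq_one_iff'.1 hr
  refine ⟨v, fun h => hv0 (Subtype.ext h), fun w => ?_⟩
  obtain ⟨c, hc⟩ := hv ⟨p w, w, rfl⟩
  exact ⟨c, (congrArg Subtype.val hc).symm⟩

theorem norm_pos_of_finrank_range {p : PlaneEnd}
    (hr : Module.finrank ℝ (LinearMap.range (p : Plane →ₗ[ℝ] Plane)) = 1) : 0 < ‖p‖ := by
  obtain ⟨v, hv, -⟩ := exists_ne_zero_mem_range hr
  rw [norm_pos_iff]
  rintro rfl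
  exact hv rfl

/-- An endomorphism stretches all vectors of a line by the same factor, which can be read off
from any endomorphism having that line as its range. -/
theorem norm_act_apply_range (g : GL (Fin 2) ℝ) {p : PlaneEnd}
    (hr : Module.finrank ℝ (LinearMap.range (p : Plane →ₗ[ℝ] Plane)) = 1) (w : Plane) :
    ‖act g (p w)‖ = ‖act g * p‖ / ‖p‖ * ‖p w‖ := by
  obtain ⟨v, hv0, hv⟩ := exists_ne_zero_mem_range hr
  set r : ℝ := ‖act g (p v)‖ / ‖p v‖ with hrdef
  have hr0 : 0 ≤ r := by positivity
  have hpv : 0 < ‖p v‖ := norm_pos_iff.2 hv0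
  have key : ∀ u, ‖act g (p u)‖ = r * ‖p u‖ := fun u => by
    obtain ⟨c, hc⟩ := hv u
    rw [hc, map_smul, norm_smul, norm_smul, hrdef]
    field_simp
  have h1 : ‖act g * p‖ ≤ r * ‖p‖ := by
    refine ContinuousLinearMap.opNorm_le_bound _ (by positivity) fun u => ?_
    change ‖act g (p u)‖ ≤ _
    rw [key, mul_assoc]
    exact mul_le_mul_of_nonneg_left (p.le_opNorm u) hr0
  have hp := norm_pos_of_finrank_range hr
  have h2 : r * ‖p‖ ≤ ‖act g * p‖ := by
    rcases hr0.eq_or_lt with h | h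
    · rw [← h, zero_mul]; exact norm_nonneg _
    · rw [← le_div_iff₀' h]
      refine ContinuousLinearMap.opNorm_le_bound _ (by positivity) fun u => ?_
      rw [div_mul_eq_mul_div, le_div_iff₀' h, ← key]
      exact (act g * p).le_opNorm u
  rw [le_antisymm h1 h2, mul_div_assoc, div_self hp.ne', mul_one, key]

variable {X : Type*} [TopologicalSpace X]

/-- The factor by which the `m`-th iterate of the cocycle stretches the range of `P x`. -/
noncomputable def stretch (T : X ≃ₜ X) (A : X → GL (Fin 2) ℝ) (P : C(X, PlaneEnd)) (m : ℕ)
    (x : X) : ℝ :=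
  ‖act (iter T A m x) * P x‖ / ‖P x‖

variable {T : X ≃ₜ X} {A : X → GL (Fin 2) ℝ} {P : C(X, PlaneEnd)} {n : ℕ}

theorem IsDominatedAlong.norm_iter_apply (h : IsDominatedAlong T A P n) (m : ℕ) (x : X)
    (w : Plane) : ‖act (iter T A m x) (P x w)‖ = stretch T A P m x * ‖P x w‖ :=
  norm_act_apply_range _ (h.rank x) w

theorem IsDominatedAlong.stretch_pos (h : IsDominatedAlong T A P n) (m : ℕ) (x : X) :
    0 < stretch T A P m x := by
  obtain ⟨v, hv, -⟩ := exists_ne_zero_mem_range (h.rank x)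
  have h1 := h.norm_iter_apply m x v
  have h2 : 0 < ‖act (iter T A m x) (P x v)‖ := norm_pos_iff.2 (act_apply_ne_zero _ hv)
  rw [h1] at h2
  exact pos_of_mul_pos_left h2 (norm_nonneg _)

theorem IsDominatedAlong.iter_apply_range (h : IsDominatedAlong T A P n) (m : ℕ) (x : X)
    (w : Plane) : act (iter T A m x) (P x w) = P (T^[m] x) (act (iter T A m x) w) :=
  (DFunLike.congr_fun (h.comm_iterate m x) w).symm

theorem IsDominatedAlong.stretch_add (h : IsDominatedAlong T A P n) (l m : ℕ) (x : X) :
    stretch T A P (l + m) x = stretch T A P l (T^[m] x) * stretch T A P m x := by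
  obtain ⟨v, hv, -⟩ := exists_ne_zero_mem_range (h.rank x)
  have hv' : ‖P x v‖ ≠ 0 := (norm_pos_iff.2 hv).ne'
  apply mul_right_cancel₀ hv'
  rw [← h.norm_iter_apply, mul_assoc, ← h.norm_iter_apply, iter_add, act_mul,
    h.iter_apply_range m x v, ← h.norm_iter_apply, ← h.iter_apply_range]
  rfl

theorem IsDominatedAlong.log_stretch (h : IsDominatedAlong T A P n) (m : ℕ) (x : X) :
    Real.log (stretch T A P m x) =
      birkhoffSum T (fun y => Real.log (stretch T A P 1 y)) m x := by
  induction m with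
  | zero =>
    rw [birkhoffSum_zero, stretch, iter, act_one, one_mul,
      div_self (norm_pos_of_finrank_range (h.rank x)).ne', Real.log_one]
  | succ m ih =>
    rw [birkhoffSum_succ, ← ih, add_comm m 1, h.stretch_add,
      Real.log_mul (h.stretch_pos _ _).ne' (h.stretch_pos _ _).ne', add_comm]

theorem IsDominatedAlong.continuous_stretch (h : IsDominatedAlong T A P n) (hA : Continuous A)
    (m : ℕ) : Continuous (stretch T A P m) :=
  ((continuous_act.comp (continuous_iter T hA m)).mul P.continuous).norm.div
    P.continuous.norm fun x => (norm_pos_of_finrank_range (h.rank x)).ne'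

theorem IsDominatedAlong.norm_iter_mul (h : IsDominatedAlong T A P n) (m : ℕ) (x : X) :
    ‖act (iter T A m x) * P x‖ = stretch T A P m x * ‖P x‖ := by
  rw [stretch, div_mul_cancel₀ _ (norm_pos_of_finrank_range (h.rank x)).ne']

/-- Domination after `n` steps gives this bound with constant `1`, since on the range of `P` the
inverse of the iterate shrinks by exactly the inverse of the stretching factor. -/
theorem IsDominatedAlong.norm_iter_mul_one_sub_le (h : IsDominatedAlong T A P n) (x : X) :
    ‖act (iter T A n x) * (1 - P x)‖ ≤ stretch T A P n x := by
  obtain ⟨v, hv, -⟩ := exists_ne_zero_mem_range (h.rank x)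
  have hs := h.stretch_pos n x
  have hv' : 0 < ‖P x v‖ := norm_pos_iff.2 hv
  have h1 : ‖P x v‖ ≤ ‖act (iter T A n x)⁻¹ * P (T^[n] x)‖ * (stretch T A P n x * ‖P x v‖) := by
    rw [← h.norm_iter_apply]
    have := (act (iter T A n x)⁻¹ * P (T^[n] x)).le_opNorm (act (iter T A n x) (P x v))
    change ‖act (iter T A n x)⁻¹ (P (T^[n] x) (act (iter T A n x) (P x v)))‖ ≤ _ at this
    rw [← h.iter_apply_range, act_inv_apply_act] at this
    have hi : P x (P x v) = P x v := DFunLike.congr_fun (h.idem x) v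
    rwa [hi] at this
  have h2 : 1 ≤ ‖act (iter T A n x)⁻¹ * P (T^[n] x)‖ * stretch T A P n x := by
    rw [← mul_assoc] at h1
    exact le_of_mul_le_mul_right (by rwa [one_mul]) hv'
  have h3 := (h.contr x).le
  have h0 : 0 ≤ ‖act (iter T A n x) * (1 - P x)‖ := norm_nonneg _
  calc ‖act (iter T A n x) * (1 - P x)‖
      ≤ ‖act (iter T A n x) * (1 - P x)‖ *
          (‖act (iter T A n x)⁻¹ * P (T^[n] x)‖ * stretch T A P n x) :=
        le_mul_of_one_le_right h0 h2
    _ = (‖act (iter T A n x) * (1 - P x)‖ * ‖act (iter T A n x)⁻¹ * P (T^[n] x)‖) *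
          stretch T A P n x := by ring
    _ ≤ 1 / 2 * stretch T A P n x := mul_le_mul_of_nonneg_right h3 hs.le
    _ ≤ stretch T A P n x := by linarith

/-- At the multiples of the number of steps, the constant is the norm of the projection onto the
weak line, so that it is uniform under small perturbations. -/
theorem IsDominatedAlong.norm_iter_mul_one_sub_le_mul (h : IsDominatedAlong T A P n) (k : ℕ)
    (x : X) :
    ‖act (iter T A (k * n) x) * (1 - P x)‖ ≤ stretch T A P (k * n) x * ‖1 - P x‖ := by
  have hQ : (1 - P x) * (1 - P x) = 1 - P x := by simp [mul_sub, sub_mul, h.idem]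
  induction k with
  | zero =>
    rw [zero_mul, iter, act_one, one_mul, stretch, iter, act_one, one_mul,
      div_self (norm_pos_of_finrank_range (h.rank x)).ne', one_mul]
  | succ k ih =>
    have e : act (iter T A ((k + 1) * n) x) * (1 - P x) =
        (act (iter T A n (T^[k * n] x)) * (1 - P (T^[k * n] x))) *
          (act (iter T A (k * n) x) * (1 - P x)) := by
      have e1 : (1 - P (T^[k * n] x)) * act (iter T A (k * n) x) =
          act (iter T A (k * n) x) * (1 - P x) := by
        rw [sub_mul, mul_sub, h.comm_iterate, one_mul, mul_one]
      have e2 : (1 - P (T^[k * n] x)) * (act (iter T A (k * n) x) * (1 - P x)) =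
          act (iter T A (k * n) x) * (1 - P x) := by
        rw [← mul_assoc, e1, mul_assoc, hQ]
      rw [mul_assoc _ (1 - P (T^[k * n] x)), e2, Nat.succ_mul, add_comm (k * n), iter_add,
        act_mul, mul_assoc]
    have e3 : stretch T A P ((k + 1) * n) x * ‖1 - P x‖ =
        stretch T A P n (T^[k * n] x) * (stretch T A P (k * n) x * ‖1 - P x‖) := by
      rw [Nat.succ_mul, add_comm (k * n), h.stretch_add, mul_assoc]
    rw [e, e3]
    exact (norm_mul_le _ _).trans (mul_le_mul (h.norm_iter_mul_one_sub_le _) ih (norm_nonneg _)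
      (h.stretch_pos _ _).le)

theorem IsDominatedAlong.norm_iter_le (h : IsDominatedAlong T A P n) (k : ℕ) (x : X) :
    ‖act (iter T A (k * n) x)‖ ≤ stretch T A P (k * n) x * (‖P x‖ + ‖1 - P x‖) := by
  have e : act (iter T A (k * n) x) =
      act (iter T A (k * n) x) * P x + act (iter T A (k * n) x) * (1 - P x) := by
    rw [← mul_add, add_sub_cancel, mul_one]
  rw [mul_add, ← h.norm_iter_mul]
  conv_lhs => rw [e]
  exact (norm_add_le _ _).trans (add_le_add le_rfl (h.norm_iter_mul_one_sub_le_mul k x))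

theorem IsDominatedAlong.stretch_le_norm_iter (h : IsDominatedAlong T A P n) (m : ℕ) (x : X) :
    stretch T A P m x ≤ ‖act (iter T A m x)‖ := by
  rw [stretch, div_le_iff₀ (norm_pos_of_finrank_range (h.rank x))]
  exact norm_mul_le _ _

theorem IsDominatedAlong.exists_norm_iter_le [CompactSpace X] (h : IsDominatedAlong T A P n)
    (hA : Continuous A) :
    ∃ C > 0, ∀ m x, ‖act (iter T A m x)‖ ≤ C * stretch T A P m x := by
  have h1 : ∀ r : ℕ, ∃ C : ℝ, ∀ x, ‖act (iter T A r x)‖ / stretch T A P r x ≤ C := fun r => by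
    have hc : Continuous fun x => ‖act (iter T A r x)‖ / stretch T A P r x :=
      (continuous_act.comp (continuous_iter T hA r)).norm.div (h.continuous_stretch hA r)
        fun x => (h.stretch_pos r x).ne'
    obtain ⟨C, hC⟩ := (isCompact_range hc).bddAbove
    exact ⟨C, fun x => hC ⟨x, rfl⟩⟩
  choose c hc using h1
  set M : ℝ := ∑ r ∈ Finset.range n, |c r|
  have hM0 : 0 ≤ M := Finset.sum_nonneg fun _ _ => abs_nonneg _
  have hM : ∀ r < n, ∀ x, ‖act (iter T A r x)‖ ≤ M * stretch T A P r x := fun r hr x => by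
    rw [← div_le_iff₀ (h.stretch_pos r x)]
    exact (hc r x).trans ((le_abs_self _).trans
      (Finset.single_le_sum (f := fun r => |c r|) (fun _ _ => abs_nonneg _)
        (Finset.mem_range.2 hr)))
  refine ⟨M * (‖P‖ + ‖1 - P‖) + 1, by positivity, fun m x => ?_⟩
  have hm : m = m % n + m / n * n := by rw [mul_comm]; exact (Nat.mod_add_div m n).symm
  have hs := h.stretch_pos m x
  have h2 : ‖P x‖ + ‖1 - P x‖ ≤ ‖P‖ + ‖1 - P‖ :=
    add_le_add (P.norm_coe_le_norm x) ((1 - P).norm_coe_le_norm x)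
  have h3 : ‖act (iter T A m x)‖ ≤ M * (‖P‖ + ‖1 - P‖) * stretch T A P m x := by
    rw [hm, iter_add, act_mul, h.stretch_add]
    calc _ ≤ (M * stretch T A P (m % n) (T^[m / n * n] x)) *
          (stretch T A P (m / n * n) x * (‖P‖ + ‖1 - P‖)) :=
          (norm_mul_le _ _).trans (mul_le_mul (hM _ (Nat.mod_lt _ h.pos) _)
            ((h.norm_iter_le _ x).trans
              (mul_le_mul_of_nonneg_left h2 (h.stretch_pos _ _).le)) (norm_nonneg _)
            (mul_nonneg hM0 (h.stretch_pos _ _).le))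
      _ = _ := by ring
  linarith

end Stretch

/-! ### The upper Lyapunov exponent of a dominated cocycle -/

section Exponent

variable {X : Type*} [MetricSpace X] [CompactSpace X] [MeasurableSpace X] [BorelSpace X]
  {T : X ≃ₜ X} {μ : Measure X} [IsProbabilityMeasure μ] {A : X → GL (Fin 2) ℝ}
  {P : C(X, PlaneEnd)} {n : ℕ}

theorem IsDominatedAlong.ae_tendsto_log_stretch (h : IsDominatedAlong T A P n)
    (hA : Continuous A) (hT : Ergodic T μ) :
    ∀ᵐ x ∂μ, Tendsto (fun m : ℕ => (1 / (m : ℝ)) * Real.log (stretch T A P m x)) atTop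
      (𝓝 (∫ y, Real.log (stretch T A P 1 y) ∂μ)) := by
  have hc : Continuous fun y => Real.log (stretch T A P 1 y) :=
    (h.continuous_stretch hA 1).log fun y => (h.stretch_pos 1 y).ne'
  filter_upwards [ae_tendsto_birkhoffAverage hT hc.measurable
    (hc.integrable_of_hasCompactSupport (HasCompactSupport.of_compactSpace _))] with x hx
  exact hx.congr fun m => by rw [← h.log_stretch m]

theorem tendsto_log_of_comparable {s a : ℕ → ℝ} {c C L : ℝ} {φ : ℕ → ℕ}
    (hφ : Tendsto φ atTop atTop) (hs : ∀ m, 0 < s m) (hc : 0 < c) (hC : 0 < C)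
    (h1 : ∀ m, c * s m ≤ a m) (h2 : ∀ m, a m ≤ C * s m)
    (hL : Tendsto (fun m => (1 / (φ m : ℝ)) * Real.log (s m)) atTop (𝓝 L)) :
    Tendsto (fun m => (1 / (φ m : ℝ)) * Real.log (a m)) atTop (𝓝 L) := by
  have hinv : Tendsto (fun m => 1 / (φ m : ℝ)) atTop (𝓝 0) :=
    tendsto_one_div_atTop_nhds_zero_nat.comp hφ
  have hlow : Tendsto (fun m => (1 / (φ m : ℝ)) * Real.log c +
      (1 / (φ m : ℝ)) * Real.log (s m)) atTop (𝓝 L) := by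
    simpa using (hinv.mul_const (Real.log c)).add hL
  have hup : Tendsto (fun m => (1 / (φ m : ℝ)) * Real.log C +
      (1 / (φ m : ℝ)) * Real.log (s m)) atTop (𝓝 L) := by
    simpa using (hinv.mul_const (Real.log C)).add hL
  refine tendsto_of_tendsto_of_tendsto_of_le_of_le hlow hup (fun m => ?_) fun m => ?_
  · simp only
    rw [← mul_add, ← Real.log_mul hc.ne' (hs m).ne']
    exact mul_le_mul_of_nonneg_left (Real.log_le_log (mul_pos hc (hs m)) (h1 m)) (by positivity)
  · simp only
    rw [← mul_add, ← Real.log_mul hC.ne' (hs m).ne']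
    exact mul_le_mul_of_nonneg_left
      (Real.log_le_log ((mul_pos hc (hs m)).trans_le (h1 m)) (h2 m)) (by positivity)

/-- The exponent is the space average of the logarithmic stretching of the strong line. -/
theorem IsDominatedAlong.isUpperLyapunovExponent (h : IsDominatedAlong T A P n)
    (hA : Continuous A) (hT : Ergodic T μ) :
    IsUpperLyapunovExponent μ T A (∫ y, Real.log (stretch T A P 1 y) ∂μ) := by
  obtain ⟨C, hC, hle⟩ := h.exists_norm_iter_le hA
  filter_upwards [h.ae_tendsto_log_stretch hA hT] with x hx
  exact tendsto_log_of_comparable (φ := fun m => m) tendsto_id (fun m => h.stretch_pos m x)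
    one_pos hC (fun m => by rw [one_mul]; exact h.stretch_le_norm_iter m x)
    (fun m => hle m x) hx

theorem upperLyapunovExponent_eq {X : Type*} [TopologicalSpace X] [MeasurableSpace X]
    {T : X ≃ₜ X} {μ : Measure X} [IsProbabilityMeasure μ] {A : X → GL (Fin 2) ℝ} {L : ℝ}
    (h : IsUpperLyapunovExponent μ T A L) :
    upperLyapunovExponent μ T A = L := by
  have hex : ∃ L, IsUpperLyapunovExponent μ T A L := ⟨L, h⟩
  rw [upperLyapunovExponent, dif_pos hex]
  exact hex.choose_spec.unique h

end Exponent

/-! ### Matrix coefficients of the iterates -/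

section Pairing

variable {X : Type*} [TopologicalSpace X] {T : X ≃ₜ X} {A B : X → GL (Fin 2) ℝ}
  {P Q : C(X, PlaneEnd)} {n n' : ℕ}

/-- If `Q` is close to `P`, the growth of the cocycle of `B` along the range of `Q` is read off
from its matrix coefficients with respect to unit vectors in the ranges of `P`. -/
theorem IsDominatedAlong.le_abs_inner_iter [CompactSpace X] (hB : IsDominatedAlong T B Q n)
    (hA : IsDominatedAlong T A P n') {ε : ℝ} (hε : ε ≤ 1 / 8) (hεP : ε * ‖1 - P‖ ≤ 1 / 8)
    (hPQ : ‖Q - P‖ ≤ ε) (k : ℕ) {x : X} {v w : Plane} (hv : P x v = v) (hv1 : ‖v‖ = 1)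
    (hw : P (T^[k * n] x) w = w) (hw1 : ‖w‖ = 1) :
    1 / 2 * stretch T B Q (k * n) x ≤ |inner ℝ w (act (iter T B (k * n) x) v)| := by
  set s := stretch T B Q (k * n) x with hs
  have hspos : 0 < s := hB.stretch_pos _ _
  set y := T^[k * n] x
  set M := act (iter T B (k * n) x)
  have hε0 : 0 ≤ ε := (by positivity : (0 : ℝ) ≤ ‖Q - P‖).trans hPQ
  have hdist : ∀ z u, ‖Q z u - P z u‖ ≤ ε * ‖u‖ := fun z u =>
    ((Q z - P z).le_opNorm u).trans
      (mul_le_mul_of_nonneg_right (((Q - P).norm_coe_le_norm z).trans hPQ) (norm_nonneg _))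
  have hu : ‖v - Q x v‖ ≤ ε := by
    have := hdist x v
    rwa [hv, hv1, mul_one, norm_sub_rev] at this
  have hu1 : 1 - ε ≤ ‖Q x v‖ := by
    have := norm_sub_norm_le v (Q x v)
    linarith
  set z := M (Q x v)
  have hz : ‖z‖ = s * ‖Q x v‖ := hB.norm_iter_apply _ x v
  have hzQ : Q y z = z := by
    have h1 : Q x (Q x v) = Q x v := DFunLike.congr_fun (hB.idem x) v
    have := hB.iter_apply_range (k * n) x (Q x v)
    rw [h1] at this
    exact this.symm
  have hzP : ‖z - P y z‖ ≤ ε * ‖z‖ := by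
    have := hdist y z
    rwa [hzQ] at this
  -- the component of `z` along `w` is almost all of it
  have hin : (1 - 2 * ε) * ‖z‖ ≤ |inner ℝ w z| := by
    obtain ⟨c, hc⟩ : ∃ c : ℝ, P y z = c • w := by
      obtain ⟨u, hu0, hu⟩ := exists_ne_zero_mem_range (hA.rank y)
      obtain ⟨a, ha⟩ := hu w
      obtain ⟨b, hb⟩ := hu z
      rw [hw] at ha
      have ha0 : a ≠ 0 := by
        rintro rfl
        rw [zero_smul] at ha
        rw [ha, norm_zero] at hw1
        exact zero_ne_one hw1
      exact ⟨b / a, by rw [hb, ha, smul_smul, div_mul_cancel₀ _ ha0]⟩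
    have h1 : inner ℝ w z = c + inner ℝ w (z - P y z) := by
      rw [inner_sub_right, hc, inner_smul_right, real_inner_self_eq_norm_sq, hw1]; ring
    have h2 : |inner ℝ w (z - P y z)| ≤ ε * ‖z‖ := by
      refine (abs_real_inner_le_norm _ _).trans ?_
      rw [hw1, one_mul]
      exact hzP
    have h3 : ‖P y z‖ = |c| := by rw [hc, norm_smul, hw1, mul_one, Real.norm_eq_abs]
    have h4 : ‖z‖ - ε * ‖z‖ ≤ |c| := by
      have := norm_sub_norm_le z (P y z)
      linarith
    have h5 : |c| ≤ |inner ℝ w z| + |inner ℝ w (z - P y z)| := by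
      have : c = inner ℝ w z - inner ℝ w (z - P y z) := by rw [h1]; ring
      calc |c| = |inner ℝ w z - inner ℝ w (z - P y z)| := by rw [← this]
        _ ≤ _ := abs_sub _ _
    linarith
  -- `v - Q x v` lies in the kernel of `Q x`, where the growth is dominated
  have hrest : ‖M (v - Q x v)‖ ≤ s * (‖1 - P‖ + ε) * ε := by
    have e : M (v - Q x v) = (M * (1 - Q x)) (v - Q x v) := by
      have h1 : Q x (Q x v) = Q x v := DFunLike.congr_fun (hB.idem x) v
      change _ = M ((v - Q x v) - Q x (v - Q x v))
      rw [map_sub (Q x), h1, sub_self, sub_zero]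
    have h1 : ‖1 - Q x‖ ≤ ‖1 - P‖ + ε := by
      have : 1 - Q x = (1 - P) x - (Q - P) x := by
        simp
      rw [this]
      exact (norm_sub_le _ _).trans (add_le_add ((1 - P).norm_coe_le_norm x)
        (((Q - P).norm_coe_le_norm x).trans hPQ))
    rw [e]
    refine ((M * (1 - Q x)).le_opNorm _).trans (mul_le_mul ?_ hu (norm_nonneg _) (by positivity))
    exact (hB.norm_iter_mul_one_sub_le_mul k x).trans (mul_le_mul_of_nonneg_left h1 hspos.le)
  have hsplit : inner ℝ w (M v) = inner ℝ w z + inner ℝ w (M (v - Q x v)) := by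
    rw [← inner_add_right, ← map_add, add_sub_cancel]
  have hrest' : |inner ℝ w (M (v - Q x v))| ≤ s * (‖1 - P‖ + ε) * ε := by
    refine (abs_real_inner_le_norm _ _).trans ?_
    rwa [hw1, one_mul]
  have htri : |inner ℝ w z| ≤ |inner ℝ w (M v)| + |inner ℝ w (M (v - Q x v))| := by
    have : inner ℝ w z = inner ℝ w (M v) - inner ℝ w (M (v - Q x v)) := by rw [hsplit]; ring
    rw [this]
    exact abs_sub _ _
  have h6 : (1 - 2 * ε) * (s * (1 - ε)) ≤ |inner ℝ w z| := by
    refine le_trans ?_ hin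
    rw [hz]
    exact mul_le_mul_of_nonneg_left (mul_le_mul_of_nonneg_left hu1 hspos.le) (by linarith)
  have h7 : 1 / 2 * s ≤ (1 - 2 * ε) * (s * (1 - ε)) - s * (‖1 - P‖ + ε) * ε := by
    have : (1 : ℝ) / 2 ≤ (1 - 2 * ε) * (1 - ε) - (ε * ‖1 - P‖ + ε * ε) := by nlinarith
    calc 1 / 2 * s ≤ ((1 - 2 * ε) * (1 - ε) - (ε * ‖1 - P‖ + ε * ε)) * s :=
          mul_le_mul_of_nonneg_right this hspos.le
      _ = _ := by ring
  linarith

theorem IsDominatedAlong.abs_inner_iter_le (hB : IsDominatedAlong T B Q n) (k : ℕ) {x : X}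
    {v w : Plane} (hv1 : ‖v‖ = 1) (hw1 : ‖w‖ = 1) :
    |inner ℝ w (act (iter T B (k * n) x) v)| ≤
      (‖Q x‖ + ‖1 - Q x‖) * stretch T B Q (k * n) x := by
  refine (abs_real_inner_le_norm _ _).trans ?_
  rw [hw1, one_mul, mul_comm (_ + _)]
  refine ((act (iter T B (k * n) x)).le_opNorm v).trans ?_
  rw [hv1, mul_one]
  exact hB.norm_iter_le k x

end Pairing

/-! ### Matrix coefficients as real-rooted polynomials -/

section RealRooted

open Polynomial

/-- The vector `Mₙ₋₁ (1 + X J) ⋯ M₀ (1 + X J) v`, where `J` is the rotation by a right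
angle, with entries polynomials in `X`: up to powers of `cos φ`, its value at `tan φ` is
`Mₙ₋₁ R_φ ⋯ M₀ R_φ v`. -/
noncomputable def polyVec (M : ℕ → GL (Fin 2) ℝ) (v : Plane) : ℕ → ℂ[X] × ℂ[X]
  | 0 => (C (v 0 : ℂ), C (v 1 : ℂ))
  | n + 1 =>
    let u := polyVec M v n
    (C (M n 0 0 : ℂ) * (u.1 - X * u.2) + C (M n 0 1 : ℂ) * (u.2 + X * u.1),
      C (M n 1 0 : ℂ) * (u.1 - X * u.2) + C (M n 1 1 : ℂ) * (u.2 + X * u.1))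

/-- The pairing of `polyVec` with a real vector. -/
noncomputable def pairPoly (M : ℕ → GL (Fin 2) ℝ) (v w : Plane) (n : ℕ) : ℂ[X] :=
  C (w 0 : ℂ) * (polyVec M v n).1 + C (w 1 : ℂ) * (polyVec M v n).2

theorem natDegree_polyVec_le (M : ℕ → GL (Fin 2) ℝ) (v : Plane) (n : ℕ) :
    (polyVec M v n).1.natDegree ≤ n ∧ (polyVec M v n).2.natDegree ≤ n := by
  induction n with
  | zero => simp [polyVec]
  | succ n ih =>
    obtain ⟨h1, h2⟩ := ih
    have hX : ∀ p : ℂ[X], p.natDegree ≤ n → (X * p).natDegree ≤ n + 1 := fun p hp => by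
      rw [add_comm]; exact natDegree_mul_le_of_le natDegree_X_le hp
    have ha : ((polyVec M v n).1 - X * (polyVec M v n).2).natDegree ≤ n + 1 :=
      natDegree_sub_le_of_le (h1.trans n.le_succ) (hX _ h2)|>.trans (by simp)
    have hb : ((polyVec M v n).2 + X * (polyVec M v n).1).natDegree ≤ n + 1 :=
      natDegree_add_le_of_degree_le (h2.trans n.le_succ) (hX _ h1)
    exact ⟨natDegree_add_le_of_degree_le ((natDegree_C_mul_le _ _).trans ha)
      ((natDegree_C_mul_le _ _).trans hb), natDegree_add_le_of_degree_le
      ((natDegree_C_mul_le _ _).trans ha) ((natDegree_C_mul_le _ _).trans hb)⟩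

theorem natDegree_pairPoly_le (M : ℕ → GL (Fin 2) ℝ) (v w : Plane) (n : ℕ) :
    (pairPoly M v w n).natDegree ≤ n :=
  natDegree_add_le_of_degree_le
    ((natDegree_C_mul_le _ _).trans (natDegree_polyVec_le M v n).1)
    ((natDegree_C_mul_le _ _).trans (natDegree_polyVec_le M v n).2)

/-- The Hermitian form `Im (conj a * b)` on `ℂ²`: its sign tells whether `b / a` lies in the
upper or the lower half plane. -/
def imForm (a b : ℂ) : ℝ := a.re * b.im - a.im * b.re

theorem imForm_real_matrix (a b : ℂ) (p q r s : ℝ) :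
    imForm (p * a + q * b) (r * a + s * b) = (p * s - q * r) * imForm a b := by
  simp [imForm]
  ring

theorem imForm_rotate (a b z : ℂ) :
    imForm (a - z * b) (b + z * a) =
      (1 + Complex.normSq z) * imForm a b + z.im * (Complex.normSq a + Complex.normSq b) := by
  simp [imForm, Complex.normSq_apply]
  ring

/-- At a nonreal point, the value of `polyVec` points into the half plane of that point: the
matrices of positive determinant preserve half planes, and `1 + z J` maps the closed half plane
containing `z` into its interior. -/
theorem im_mul_imForm_polyVec_pos {M : ℕ → GL (Fin 2) ℝ}
    (hM : ∀ i, M i ∈ Matrix.GLPos (Fin 2) ℝ) {v : Plane} (hv : v ≠ 0) {z : ℂ} (hz : z.im ≠ 0)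
    (n : ℕ) :
    0 < z.im * imForm ((polyVec M v (n + 1)).1.eval z) ((polyVec M v (n + 1)).2.eval z) := by
  have step : ∀ n, 0 ≤ z.im * imForm ((polyVec M v n).1.eval z) ((polyVec M v n).2.eval z) →
      ((polyVec M v n).1.eval z ≠ 0 ∨ (polyVec M v n).2.eval z ≠ 0) →
      0 < z.im * imForm ((polyVec M v (n + 1)).1.eval z) ((polyVec M v (n + 1)).2.eval z) := by
    intro n h0 hne
    set a := (polyVec M v n).1.eval z with ha
    set b := (polyVec M v n).2.eval z with hb
    have e1 : (polyVec M v (n + 1)).1.eval z =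
        (M n 0 0 : ℂ) * (a - z * b) + (M n 0 1 : ℂ) * (b + z * a) := by
      simp [polyVec, ha, hb]
    have e2 : (polyVec M v (n + 1)).2.eval z =
        (M n 1 0 : ℂ) * (a - z * b) + (M n 1 1 : ℂ) * (b + z * a) := by
      simp [polyVec, ha, hb]
    have hdet : 0 < M n 0 0 * M n 1 1 - M n 0 1 * M n 1 0 := by
      have := Matrix.mem_glpos _ |>.1 (hM n)
      rwa [Matrix.GeneralLinearGroup.val_det_apply, Matrix.det_fin_two] at this
    rw [e1, e2, imForm_real_matrix, imForm_rotate]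
    have hpos : 0 < Complex.normSq a + Complex.normSq b := by
      rcases hne with h | h
      · exact add_pos_of_pos_of_nonneg (Complex.normSq_pos.2 h) (Complex.normSq_nonneg _)
      · exact add_pos_of_nonneg_of_pos (Complex.normSq_nonneg _) (Complex.normSq_pos.2 h)
    have hz2 : 0 < z.im * z.im := mul_self_pos.2 hz
    have h3 : 0 < (1 + Complex.normSq z) * (z.im * imForm a b) +
        z.im * z.im * (Complex.normSq a + Complex.normSq b) :=
      add_pos_of_nonneg_of_pos
        (mul_nonneg (add_nonneg zero_le_one (Complex.normSq_nonneg _)) h0) (mul_pos hz2 hpos)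
    calc (0 : ℝ) < (M n 0 0 * M n 1 1 - M n 0 1 * M n 1 0) *
          ((1 + Complex.normSq z) * (z.im * imForm a b) +
            z.im * z.im * (Complex.normSq a + Complex.normSq b)) := mul_pos hdet h3
      _ = _ := by ring
  induction n with
  | zero =>
    refine step 0 (by simp [polyVec, imForm]) ?_
    by_contra! h
    apply hv
    ext i
    fin_cases i
    · simpa [polyVec] using h.1
    · simpa [polyVec] using h.2
  | succ n ih =>
    refine step (n + 1) ih.le ?_
    by_contra! h
    rw [h.1, h.2] at ih
    simp [imForm] at ih

/-- Matrix coefficients of the iterates are real-rooted: at a root, the value of `polyVec` would be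
a multiple of a real vector, on which `imForm` vanishes. -/
theorem im_eq_zero_of_isRoot_pairPoly {M : ℕ → GL (Fin 2) ℝ}
    (hM : ∀ i, M i ∈ Matrix.GLPos (Fin 2) ℝ) {v w : Plane} (hv : v ≠ 0) (hw : w ≠ 0) {n : ℕ}
    {z : ℂ} (h0 : pairPoly M v w n ≠ 0) (hroot : (pairPoly M v w n).IsRoot z) : z.im = 0 := by
  by_contra hz
  cases n with
  | zero =>
    apply h0
    have : pairPoly M v w 0 = C ((w 0 : ℂ) * v 0 + w 1 * v 1) := by simp [pairPoly, polyVec]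
    rw [this] at hroot ⊢
    rw [IsRoot, eval_C] at hroot
    rw [hroot, C_0]
  | succ n =>
    have hpos := im_mul_imForm_polyVec_pos hM hv hz n
    set a := (polyVec M v (n + 1)).1.eval z with ha
    set b := (polyVec M v (n + 1)).2.eval z with hb
    have hab : (w 0 : ℂ) * a + (w 1 : ℂ) * b = 0 := by
      have : (pairPoly M v w (n + 1)).eval z = 0 := hroot
      simpa [pairPoly, ha, hb] using this
    have hre := congrArg Complex.re hab
    have him := congrArg Complex.im hab
    simp at hre him
    have h1 : w 0 * imForm a b = 0 := by
      simp only [imForm]; linear_combination b.im * hre - b.re * him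
    have h2 : w 1 * imForm a b = 0 := by
      simp only [imForm]; linear_combination a.re * him - a.im * hre
    have h3 : imForm a b ≠ 0 := by
      intro h; rw [h, mul_zero] at hpos; exact lt_irrefl _ hpos
    apply hw
    ext i
    fin_cases i
    · simpa [h3] using h1
    · simpa [h3] using h2

theorem act_apply_zero (g : GL (Fin 2) ℝ) (v : Plane) :
    act g v 0 = g 0 0 * v 0 + g 0 1 * v 1 := by
  simp [act, Matrix.mulVec, dotProduct, Fin.sum_univ_two]

theorem act_apply_one (g : GL (Fin 2) ℝ) (v : Plane) :
    act g v 1 = g 1 0 * v 0 + g 1 1 * v 1 := by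
  simp [act, Matrix.mulVec, dotProduct, Fin.sum_univ_two]

theorem act_rot_apply_zero (φ : ℝ) (v : Plane) :
    act (rot φ) v 0 = Real.cos φ * v 0 - Real.sin φ * v 1 := by
  rw [act_apply_zero]
  simp [rot, Matrix.GeneralLinearGroup.mkOfDetNeZero]
  ring

theorem act_rot_apply_one (φ : ℝ) (v : Plane) :
    act (rot φ) v 1 = Real.sin φ * v 0 + Real.cos φ * v 1 := by
  rw [act_apply_one]
  simp [rot, Matrix.GeneralLinearGroup.mkOfDetNeZero]

theorem eval_polyVec_tan {X : Type*} [TopologicalSpace X] (T : X ≃ₜ X) (A : X → GL (Fin 2) ℝ)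
    (x : X) (v : Plane) {φ : ℝ} (hφ : Real.cos φ ≠ 0) (n : ℕ) :
    (Real.cos φ : ℂ) ^ n * (polyVec (fun i => A (T^[i] x)) v n).1.eval (Real.tan φ : ℂ) =
        (act (iter T (rotated A φ) n x) v 0 : ℂ) ∧
      (Real.cos φ : ℂ) ^ n * (polyVec (fun i => A (T^[i] x)) v n).2.eval (Real.tan φ : ℂ) =
        (act (iter T (rotated A φ) n x) v 1 : ℂ) := by
  induction n with
  | zero => simp [polyVec, iter, act_one]
  | succ n ih =>
    obtain ⟨h0, h1⟩ := ih
    set y := act (iter T (rotated A φ) n x) v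
    set a := (polyVec (fun i => A (T^[i] x)) v n).1.eval (Real.tan φ : ℂ) with ha
    set b := (polyVec (fun i => A (T^[i] x)) v n).2.eval (Real.tan φ : ℂ) with hb
    have hs : (Real.cos φ : ℂ) * (Real.tan φ : ℂ) = (Real.sin φ : ℂ) := by
      rw [← Complex.ofReal_mul, mul_comm, Real.tan_mul_cos hφ]
    have hstep : act (iter T (rotated A φ) (n + 1) x) v =
        act (A (T^[n] x)) (act (rot φ) y) := by
      rw [iter, act_mul, rotated, act_mul]; rfl
    rw [hstep, act_apply_zero (A (T^[n] x)), act_apply_one (A (T^[n] x)), act_rot_apply_zero,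
      act_rot_apply_one]
    have e1 : (polyVec (fun i => A (T^[i] x)) v (n + 1)).1.eval (Real.tan φ : ℂ) =
        (A (T^[n] x) 0 0 : ℂ) * (a - (Real.tan φ : ℂ) * b) +
          (A (T^[n] x) 0 1 : ℂ) * (b + (Real.tan φ : ℂ) * a) := by
      simp [polyVec, ha, hb]
    have e2 : (polyVec (fun i => A (T^[i] x)) v (n + 1)).2.eval (Real.tan φ : ℂ) =
        (A (T^[n] x) 1 0 : ℂ) * (a - (Real.tan φ : ℂ) * b) +
          (A (T^[n] x) 1 1 : ℂ) * (b + (Real.tan φ : ℂ) * a) := by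
      simp [polyVec, ha, hb]
    rw [e1, e2]
    push_cast at h0 h1 hs ⊢
    rw [← h0, ← h1, ← hs]
    constructor <;> ring

theorem cos_pow_mul_norm_eval_pairPoly {X : Type*} [TopologicalSpace X] (T : X ≃ₜ X)
    (A : X → GL (Fin 2) ℝ) (x : X) (v w : Plane) {φ : ℝ} (hφ : 0 < Real.cos φ) (n : ℕ) :
    Real.cos φ ^ n * ‖(pairPoly (fun i => A (T^[i] x)) v w n).eval (Real.tan φ : ℂ)‖ =
      |inner ℝ w (act (iter T (rotated A φ) n x) v)| := by
  obtain ⟨h0, h1⟩ := eval_polyVec_tan T A x v hφ.ne' n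
  have hin : inner ℝ w (act (iter T (rotated A φ) n x) v) =
      w 0 * act (iter T (rotated A φ) n x) v 0 + w 1 * act (iter T (rotated A φ) n x) v 1 := by
    simp [PiLp.inner_apply, Fin.sum_univ_two, mul_comm]
  have e : (Real.cos φ : ℂ) ^ n *
      (pairPoly (fun i => A (T^[i] x)) v w n).eval (Real.tan φ : ℂ) =
      ((inner ℝ w (act (iter T (rotated A φ) n x) v) : ℝ) : ℂ) := by
    rw [hin, Complex.ofReal_add, Complex.ofReal_mul, Complex.ofReal_mul, ← h0, ← h1]
    simp only [pairPoly, eval_add, eval_mul, eval_C]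
    ring
  rw [← Real.norm_eq_abs, ← Complex.norm_real, ← e, norm_mul, norm_pow, Complex.norm_real,
    Real.norm_of_nonneg hφ.le]

end RealRooted

/-! ### The logarithm of a real-rooted polynomial -/

section LogPolynomial

open Polynomial

/-- The power series at `0` of the logarithm of `∏ (1 - t / r)`, with `r` running over a finite
family of real numbers away from `0`. -/
theorem exists_hasSum_log_prod (s : Multiset ℝ) {t₀ : ℝ} (ht₀ : 0 < t₀)
    (hs : ∀ r ∈ s, t₀ ≤ |r|) :
    ∃ a : ℕ → ℝ, a 2 ≤ 0 ∧ (∀ k, |a k| ≤ s.card * (t₀⁻¹) ^ k) ∧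
      ∀ t : ℝ, |t| < t₀ → (s.map fun r => |1 - t / r|).prod ≠ 0 ∧
        HasSum (fun k => a k * t ^ k) (Real.log (s.map fun r => |1 - t / r|).prod) := by
  induction s using Multiset.induction with
  | empty => exact ⟨fun _ => 0, le_rfl, by simp, by simp [hasSum_zero]⟩
  | cons r s ih =>
    obtain ⟨a, ha2, hak, hat⟩ := ih fun r hr => hs r (Multiset.mem_cons_of_mem hr)
    have hr : t₀ ≤ |r| := hs r (Multiset.mem_cons_self r s)
    have hr0 : r ≠ 0 := by
      rintro rfl; rw [abs_zero] at hr; exact absurd hr (not_le.2 ht₀)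
    -- for `k = 0` the division by zero gives the correct coefficient `0`
    refine ⟨fun k => a k - (r⁻¹) ^ k / k, ?_, fun k => ?_, fun t ht => ?_⟩
    · have : 0 ≤ (r⁻¹) ^ 2 / ((2 : ℕ) : ℝ) := by positivity
      linarith
    · have h1 : |(r⁻¹) ^ k / (k : ℝ)| ≤ (t₀⁻¹) ^ k := by
        rw [abs_div, abs_pow, abs_inv, Nat.abs_cast]
        have h2 : (|r|⁻¹) ^ k ≤ (t₀⁻¹) ^ k :=
          pow_le_pow_left₀ (by positivity) (inv_anti₀ ht₀ hr) k
        rcases Nat.eq_zero_or_pos k with rfl | hk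
        · simp
        · exact (div_le_self (by positivity) (by exact_mod_cast hk)).trans h2
      rw [Multiset.card_cons, Nat.cast_succ, add_mul, one_mul]
      exact (abs_sub _ _).trans (add_le_add (hak k) h1)
    · obtain ⟨hne, hsum⟩ := hat t ht
      have habs : |t / r| < 1 := by
        rw [abs_div, div_lt_one (abs_pos.2 hr0)]
        exact ht.trans_le hr
      have h1 : 0 < 1 - t / r := by linarith [(abs_lt.1 habs).2]
      have hlog : HasSum (fun k : ℕ => (t / r) ^ k / (k : ℝ)) (-Real.log (1 - t / r)) := by
        have := Real.hasSum_pow_div_log_of_abs_lt_one habs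
        rw [← hasSum_nat_add_iff' 1]
        simpa using this
      rw [Multiset.map_cons, Multiset.prod_cons, abs_of_pos h1]
      refine ⟨mul_ne_zero h1.ne' hne, ?_⟩
      rw [Real.log_mul h1.ne' hne]
      have := hsum.sub hlog
      rw [sub_neg_eq_add, add_comm] at this
      refine this.congr_fun fun k => ?_
      rw [sub_mul, div_pow, inv_pow]
      ring

/-- The logarithm of the modulus of a real-rooted polynomial without zeros in `(-t₀, t₀)` is a
power series there. Its coefficients are controlled by the degree, and that of `t²` is
minus half the sum of the inverse squares of the roots. -/
theorem exists_hasSum_log_norm_eval {q : ℂ[X]} {N : ℕ} (hN : q.natDegree ≤ N)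
    (hreal : ∀ z, q.IsRoot z → z.im = 0) {t₀ : ℝ} (ht₀ : 0 < t₀)
    (hne : ∀ t : ℝ, |t| < t₀ → q.eval (t : ℂ) ≠ 0) :
    ∃ a : ℕ → ℝ, a 2 ≤ 0 ∧ (∀ k, |a k| ≤ N * (t₀⁻¹) ^ k) ∧
      ∀ t : ℝ, |t| < t₀ → HasSum (fun k => a k * t ^ k)
        (Real.log ‖q.eval (t : ℂ)‖ - Real.log ‖q.eval 0‖) := by
  have hq0 : q.eval 0 ≠ 0 := by simpa using hne 0 (by simpa using ht₀)
  have hroot : ∀ z ∈ q.roots, ((z.re : ℝ) : ℂ) = z := fun z hz =>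
    Complex.ext (by simp) (by simp [hreal z (isRoot_of_mem_roots hz)])
  have hs : ∀ r ∈ q.roots.map Complex.re, t₀ ≤ |r| := by
    intro r hr
    obtain ⟨z, hz, rfl⟩ := Multiset.mem_map.1 hr
    by_contra! h
    apply hne z.re h
    rw [hroot z hz]
    exact isRoot_of_mem_roots hz
  obtain ⟨a, ha2, hak, hat⟩ := exists_hasSum_log_prod _ ht₀ hs
  refine ⟨a, ha2, fun k => (hak k).trans ?_, fun t ht => ?_⟩
  · have : ((q.roots.map Complex.re).card : ℝ) ≤ N := by
      rw [Multiset.card_map]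
      exact_mod_cast (card_roots' q).trans hN
    exact mul_le_mul_of_nonneg_right this (by positivity)
  · obtain ⟨hprod, hsum⟩ := hat t ht
    have hev : ∀ t : ℝ, ‖q.eval (t : ℂ)‖ =
        ‖q.leadingCoeff‖ * ((q.roots.map Complex.re).map fun r => |t - r|).prod := fun t => by
      conv_lhs => rw [(IsAlgClosed.splits q).eq_prod_roots]
      rw [eval_mul, eval_C, norm_mul, eval_multiset_prod, Multiset.map_map, Multiset.map_map]
      congr 1
      change (normHom : ℂ →*₀ ℝ) _ = _
      rw [map_multiset_prod, Multiset.map_map]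
      congr 1
      refine Multiset.map_congr rfl fun z hz => ?_
      simp only [Function.comp_apply, eval_sub, eval_X, eval_C]
      change ‖(t : ℂ) - z‖ = _
      conv_lhs => rw [← hroot z hz]
      rw [← Complex.ofReal_sub, Complex.norm_real, Real.norm_eq_abs]
    have hfac : ‖q.eval (t : ℂ)‖ =
        ‖q.eval 0‖ * ((q.roots.map Complex.re).map fun r => |1 - t / r|).prod := by
      have h0 := hev 0
      rw [Complex.ofReal_zero] at h0
      rw [h0, hev t, mul_assoc, ← Multiset.prod_map_mul]
      congr 2
      refine Multiset.map_congr rfl fun r hr => ?_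
      have hr0 : r ≠ 0 := by
        rintro rfl
        have := hs 0 hr
        rw [abs_zero] at this
        exact absurd this (not_le.2 ht₀)
      rw [← abs_mul]
      congr 1
      field_simp
      ring
    rwa [hfac, Real.log_mul (norm_ne_zero_iff.2 hq0) hprod, add_sub_cancel_left]

end LogPolynomial

/-! ### Limits of power series -/

section PowerSeries

/-- A compactness principle for power series: if the coefficients of a sequence of power series
have a common geometric bound, then its pointwise limits, wherever they exist, are given by one
power series with the same bound. Its coefficients are limits along an ultrafilter. -/
theorem exists_hasSum_of_tendsto {α : ℕ → ℕ → ℝ} {g : ℕ → ℝ → ℝ} {ρ : ℝ} (hρ : 0 < ρ)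
    (h2 : ∀ j, α j 2 ≤ 0) (hb : ∀ j k, |α j k| ≤ (ρ⁻¹) ^ k)
    (hsum : ∀ j t, |t| < ρ → HasSum (fun k => α j k * t ^ k) (g j t)) :
    ∃ a : ℕ → ℝ, a 2 ≤ 0 ∧ (∀ k, |a k| ≤ (ρ⁻¹) ^ k) ∧
      ∀ t L, |t| < ρ → Tendsto (fun j => g j t) atTop (𝓝 L) →
        HasSum (fun k => a k * t ^ k) L := by
  have hex : ∀ k, ∃ c ∈ Set.Icc (-(ρ⁻¹) ^ k) ((ρ⁻¹) ^ k),
      Tendsto (fun j => α j k) (hyperfilter ℕ : Filter ℕ) (𝓝 c) := fun k => by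
    have := isCompact_iff_ultrafilter_le_nhds.1
      (isCompact_Icc (a := -(ρ⁻¹) ^ k) (b := (ρ⁻¹) ^ k)) ((hyperfilter ℕ).map fun j => α j k)
      (le_principal_iff.2 (mem_map.2 (Eventually.of_forall fun j => abs_le.1 (hb j k))))
    exact this
  choose a ha hlim using hex
  refine ⟨a, le_of_tendsto' (hlim 2) h2, fun k => abs_le.2 (ha k), fun t L ht hL => ?_⟩
  have hgeo : Summable fun k : ℕ => (|t| * ρ⁻¹) ^ k :=
    summable_geometric_of_lt_one (by positivity) (by
      rw [← div_eq_mul_inv]; exact (div_lt_one hρ).2 ht)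
  have hbd : ∀ c : ℕ → ℝ, (∀ k, |c k| ≤ (ρ⁻¹) ^ k) → ∀ k, ‖c k * t ^ k‖ ≤ (|t| * ρ⁻¹) ^ k :=
    fun c hc k => by
      rw [norm_mul, norm_pow, Real.norm_eq_abs, Real.norm_eq_abs, mul_pow, mul_comm]
      exact mul_le_mul_of_nonneg_left (hc k) (by positivity)
  have htend := tendsto_tsum_of_dominated_convergence (𝓕 := (hyperfilter ℕ : Filter ℕ)) hgeo
    (fun k => (hlim k).mul_const (t ^ k)) (Eventually.of_forall fun j => hbd (α j) (hb j))
  simp only [(hsum _ t ht).tsum_eq] at htend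
  have hL' := hL.mono_left Nat.hyperfilter_le_atTop
  rw [← tendsto_nhds_unique htend hL']
  exact (Summable.of_norm_bounded hgeo (hbd a fun k => abs_le.2 (ha k))).hasSum

theorem hasFPowerSeriesOnBall_tsum {a : ℕ → ℝ} {ρ : ℝ} (hρ : 0 < ρ)
    (ha : ∀ k, |a k| ≤ (ρ⁻¹) ^ k) :
    HasFPowerSeriesOnBall (fun t : ℝ => ∑' k, a k * t ^ k)
      (FormalMultilinearSeries.ofScalars ℝ a) 0 (ENNReal.ofReal ρ) where
  r_le := by
    refine FormalMultilinearSeries.le_radius_of_bound _ 1 fun k => ?_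
    rw [FormalMultilinearSeries.ofScalars_norm, Real.coe_toNNReal _ hρ.le, Real.norm_eq_abs]
    calc |a k| * ρ ^ k ≤ (ρ⁻¹) ^ k * ρ ^ k := mul_le_mul_of_nonneg_right (ha k) (by positivity)
      _ = 1 := by rw [← mul_pow, inv_mul_cancel₀ hρ.ne', one_pow]
  r_pos := ENNReal.ofReal_pos.2 hρ
  hasSum := by
    intro t ht
    have ht' : |t| < ρ := by
      rw [Metric.eball_ofReal, mem_ball_zero_iff] at ht
      exact ht
    have hgeo : Summable fun k : ℕ => (|t| * ρ⁻¹) ^ k :=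
      summable_geometric_of_lt_one (by positivity) (by
        rw [← div_eq_mul_inv]; exact (div_lt_one hρ).2 ht')
    have hs : Summable fun k => a k * t ^ k := Summable.of_norm_bounded hgeo fun k => by
      rw [norm_mul, norm_pow, Real.norm_eq_abs, Real.norm_eq_abs, mul_pow, mul_comm]
      exact mul_le_mul_of_nonneg_left (ha k) (by positivity)
    simp only [FormalMultilinearSeries.ofScalars_apply_eq, smul_eq_mul, zero_add]
    exact hs.hasSum

theorem deriv_deriv_tsum {a : ℕ → ℝ} {ρ : ℝ} (hρ : 0 < ρ) (ha : ∀ k, |a k| ≤ (ρ⁻¹) ^ k) :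
    deriv (deriv fun t : ℝ => ∑' k, a k * t ^ k) 0 = 2 * a 2 := by
  have h := (hasFPowerSeriesOnBall_tsum hρ ha).factorial_smul (1 : ℝ) 2
  rw [FormalMultilinearSeries.ofScalars_apply_eq, ← iteratedDeriv_eq_iteratedFDeriv,
    iteratedDeriv_succ, iteratedDeriv_one] at h
  rw [← h]
  simp

end PowerSeries

/-! ### Expansion of the exponent in the tangent of the angle -/

section Expansion

variable {X : Type*} [MetricSpace X] [CompactSpace X] [MeasurableSpace X] [BorelSpace X]
  {T : X ≃ₜ X} {μ : Measure X} [IsProbabilityMeasure μ] {A : X → GL (Fin 2) ℝ}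
  {P : C(X, PlaneEnd)} {n : ℕ}

theorem exists_unit_mem_range {p : PlaneEnd} (hp : p * p = p)
    (hr : Module.finrank ℝ (LinearMap.range (p : Plane →ₗ[ℝ] Plane)) = 1) :
    ∃ v, p v = v ∧ ‖v‖ = 1 := by
  obtain ⟨u, hu, -⟩ := exists_ne_zero_mem_range hr
  refine ⟨(‖p u‖⁻¹ : ℝ) • p u, ?_, by
    rw [norm_smul, norm_inv, norm_norm, inv_mul_cancel₀ (norm_ne_zero_iff.2 hu)]⟩
  have : p (p u) = p u := DFunLike.congr_fun hp u
  rw [map_smul, this]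

/-- On a countable set of parameters `t = tan φ`, the exponent of the rotated cocycle is given by
a power series: a typical point of `X` serves all these parameters, and the matrix coefficients of
the iterates at this point are real-rooted polynomials in `t` without zeros near `0`. -/
theorem IsDominatedAlong.exists_hasSum_countable (h : IsDominatedAlong T A P n)
    (hA : Continuous A) (hpos : ∀ x, A x ∈ Matrix.GLPos (Fin 2) ℝ) (hT : Ergodic T μ) {ε ρ : ℝ}
    (hρ : 0 < ρ) (hε : ε ≤ 1 / 8) (hεP : ε * ‖1 - P‖ ≤ 1 / 8)
    (hQ : ∀ t : ℝ, |t| < ρ → ∃ Q : C(X, PlaneEnd), ‖Q - P‖ ≤ ε ∧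
      IsDominatedAlong T (rotated A (Real.arctan t)) Q n)
    {S : Set ℝ} (hS : S.Countable) :
    ∃ a : ℕ → ℝ, a 2 ≤ 0 ∧ (∀ k, |a k| ≤ (ρ⁻¹) ^ k) ∧ ∀ t ∈ S, |t| < ρ →
      HasSum (fun k => a k * t ^ k)
        (upperLyapunovExponent μ T (rotated A (Real.arctan t)) -
          upperLyapunovExponent μ T A - Real.log (Real.cos (Real.arctan t))) := by
  choose! Q hQP hQd using hQ
  set lam : ℝ → ℝ := fun t => upperLyapunovExponent μ T (rotated A (Real.arctan t)) with hlam
  have hgen : ∀ t ∈ insert 0 S, ∀ᵐ x ∂μ, |t| < ρ → Tendsto (fun m : ℕ => (1 / (m : ℝ)) *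
      Real.log (stretch T (rotated A (Real.arctan t)) (Q t) m x)) atTop (𝓝 (lam t)) := by
    intro t _
    by_cases ht : |t| < ρ
    · have hc := continuous_rotated hA (Real.arctan t)
      have e : lam t = _ := upperLyapunovExponent_eq ((hQd t ht).isUpperLyapunovExponent hc hT)
      rw [e]
      filter_upwards [(hQd t ht).ae_tendsto_log_stretch hc hT] with x hx _
      exact hx
    · exact Eventually.of_forall fun x h => absurd h ht
  -- one point `x` is typical for all the parameters at once
  obtain ⟨x, hx⟩ := ((ae_ball_iff (hS.insert 0)).2 hgen).exists
  obtain ⟨v, hv, hv1⟩ := exists_unit_mem_range (h.idem x) (h.rank x)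
  have hw : ∀ j : ℕ, ∃ w, P (T^[j * n] x) w = w ∧ ‖w‖ = 1 := fun j =>
    exists_unit_mem_range (h.idem _) (h.rank _)
  choose w hw hw1 using hw
  set q : ℕ → Polynomial ℂ := fun j => pairPoly (fun i => A (T^[i] x)) v (w j) (j * n)
  set c : ℕ → ℝ → ℝ := fun j t =>
    |inner ℝ (w j) (act (iter T (rotated A (Real.arctan t)) (j * n) x) v)|
  have hc : ∀ j t, Real.cos (Real.arctan t) ^ (j * n) * ‖(q j).eval (t : ℂ)‖ = c j t :=
    fun j t => by
      have := cos_pow_mul_norm_eval_pairPoly T A x v (w j) (Real.cos_arctan_pos t) (j * n)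
      rwa [Real.tan_arctan] at this
  have hlow : ∀ t, |t| < ρ → ∀ j,
      1 / 2 * stretch T (rotated A (Real.arctan t)) (Q t) (j * n) x ≤ c j t := fun t ht j =>
    (hQd t ht).le_abs_inner_iter h hε hεP (hQP t ht) j hv hv1 (hw j) (hw1 j)
  have hcpos : ∀ t, |t| < ρ → ∀ j, 0 < c j t := fun t ht j =>
    lt_of_lt_of_le (mul_pos (by norm_num) ((hQd t ht).stretch_pos _ _)) (hlow t ht j)
  have hqne : ∀ j (t : ℝ), |t| < ρ → (q j).eval (t : ℂ) ≠ 0 := fun j t ht h0 => by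
    have h1 := hcpos t ht j
    rw [← hc, h0, norm_zero, mul_zero] at h1
    exact lt_irrefl _ h1
  have hv0 : v ≠ 0 := fun h => by rw [h, norm_zero] at hv1; exact zero_ne_one hv1
  have hw0 : ∀ j, w j ≠ 0 := fun j h => by
    have := hw1 j; rw [h, norm_zero] at this; exact zero_ne_one this
  have hq : ∀ j, ∃ b : ℕ → ℝ, b 2 ≤ 0 ∧ (∀ k, |b k| ≤ ((j * n : ℕ) : ℝ) * (ρ⁻¹) ^ k) ∧
      ∀ t : ℝ, |t| < ρ → HasSum (fun k => b k * t ^ k)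
        (Real.log ‖(q j).eval (t : ℂ)‖ - Real.log ‖(q j).eval 0‖) := fun j => by
    refine exists_hasSum_log_norm_eval (natDegree_pairPoly_le _ _ _ _) (fun z hz => ?_) hρ
      (hqne j)
    refine im_eq_zero_of_isRoot_pairPoly (fun i => hpos _) hv0 (hw0 j) (fun h0 => ?_) hz
    apply hqne j 0 (by simpa using hρ)
    change Polynomial.eval _ (pairPoly _ _ _ _) = 0
    rw [h0, Polynomial.eval_zero]
  choose b hb2 hbk hbs using hq
  obtain ⟨a, ha2, hak, has⟩ := exists_hasSum_of_tendsto (ρ := ρ)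
    (α := fun j k => 1 / ((j * n : ℕ) : ℝ) * b j k)
    (g := fun j t => 1 / ((j * n : ℕ) : ℝ) *
      (Real.log ‖(q j).eval (t : ℂ)‖ - Real.log ‖(q j).eval 0‖)) hρ
    (fun j => mul_nonpos_of_nonneg_of_nonpos (by positivity) (hb2 j))
    (fun j k => by
      rw [abs_mul, abs_of_nonneg (by positivity : (0 : ℝ) ≤ 1 / ((j * n : ℕ) : ℝ))]
      calc _ ≤ 1 / ((j * n : ℕ) : ℝ) * (((j * n : ℕ) : ℝ) * (ρ⁻¹) ^ k) :=
            mul_le_mul_of_nonneg_left (hbk j k) (by positivity)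
        _ = (((j * n : ℕ) : ℝ) / ((j * n : ℕ) : ℝ)) * (ρ⁻¹) ^ k := by ring
        _ ≤ 1 * (ρ⁻¹) ^ k := mul_le_mul_of_nonneg_right (div_self_le_one _) (by positivity)
        _ = _ := one_mul _)
    (fun j t ht => by
      simpa only [mul_assoc] using (hbs j t ht).mul_left (1 / ((j * n : ℕ) : ℝ)))
  have hmul : Tendsto (fun j : ℕ => j * n) atTop atTop :=
    tendsto_id.atTop_mul_const' h.pos
  -- the matrix coefficients grow at the rate of the exponent, since they are comparable to the
  -- stretching of the strong line
  have hclim : ∀ t ∈ insert 0 S, |t| < ρ → Tendsto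
      (fun j : ℕ => 1 / ((j * n : ℕ) : ℝ) * Real.log (c j t)) atTop (𝓝 (lam t)) := by
    intro t htS ht
    have hC : 0 < ‖Q t x‖ + ‖1 - Q t x‖ :=
      add_pos_of_pos_of_nonneg (norm_pos_of_finrank_range ((hQd t ht).rank x)) (norm_nonneg _)
    exact tendsto_log_of_comparable (φ := fun j => j * n) hmul
      (fun j => (hQd t ht).stretch_pos _ _) (by norm_num) hC (hlow t ht)
      (fun j => (hQd t ht).abs_inner_iter_le j hv1 (hw1 j)) ((hx t htS ht).comp hmul)
  refine ⟨a, ha2, hak, fun t htS ht => has t _ ht ?_⟩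
  have h0ρ : |(0 : ℝ)| < ρ := by simpa using hρ
  have hlim0 := hclim 0 (Set.mem_insert _ _) h0ρ
  have hlam0 : lam 0 = upperLyapunovExponent μ T A := by
    simp only [hlam]; rw [Real.arctan_zero, rotated_zero]
  rw [hlam0] at hlim0
  refine (((hclim t (Set.mem_insert_of_mem _ htS) ht).sub hlim0).sub_const
    (Real.log (Real.cos (Real.arctan t)))).congr' ?_
  filter_upwards [eventually_ge_atTop 1] with j hj
  have hN : ((j * n : ℕ) : ℝ) ≠ 0 := by
    have : 0 < j * n := Nat.mul_pos hj h.pos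
    exact_mod_cast this.ne'
  have hlog : ∀ s : ℝ, |s| < ρ → Real.log (c j s) =
      ((j * n : ℕ) : ℝ) * Real.log (Real.cos (Real.arctan s)) +
        Real.log ‖(q j).eval (s : ℂ)‖ := fun s hs => by
    rw [← hc, Real.log_mul (pow_pos (Real.cos_arctan_pos s) _).ne'
      (norm_ne_zero_iff.2 (hqne j s hs)), Real.log_pow]
  have hlog0 := hlog 0 h0ρ
  rw [Real.arctan_zero, Real.cos_zero, Real.log_one, mul_zero, zero_add,
    Complex.ofReal_zero] at hlog0
  rw [hlog t ht, hlog0]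
  field_simp
  ring

/-- In the variable `t = tan φ`, the exponent of the rotated cocycle minus `log (cos φ)` is
analytic near `0`, and the second coefficient of its power series is nonpositive. -/
theorem IsDominatedAlong.exists_expansion (h : IsDominatedAlong T A P n)
    (hA : Continuous A) (hpos : ∀ x, A x ∈ Matrix.GLPos (Fin 2) ℝ) (hT : Ergodic T μ) :
    ∃ G : ℝ → ℝ, AnalyticAt ℝ G 0 ∧ deriv (deriv G) 0 ≤ 0 ∧ ∀ᶠ φ in 𝓝 (0 : ℝ),
      upperLyapunovExponent μ T (rotated A φ) =
        upperLyapunovExponent μ T A + Real.log (Real.cos φ) + G (Real.tan φ) := by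
  obtain ⟨ε, hε0, hε, hεP⟩ : ∃ ε : ℝ, 0 < ε ∧ ε ≤ 1 / 8 ∧ ε * ‖1 - P‖ ≤ 1 / 8 := by
    have h0 : 0 ≤ ‖1 - P‖ := by positivity
    refine ⟨1 / (8 * (1 + ‖1 - P‖)), by positivity, ?_, ?_⟩
    · exact one_div_le_one_div_of_le (by norm_num) (by linarith)
    · rw [div_mul_eq_mul_div, div_le_div_iff₀ (by positivity) (by norm_num)]
      linarith
  have hev := h.eventually_rotated hA (Metric.closedBall_mem_nhds P hε0)
  have harc : Tendsto Real.arctan (𝓝 0) (𝓝 0) := by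
    simpa using Real.continuous_arctan.tendsto 0
  obtain ⟨ρ, hρ, hball⟩ := Metric.eventually_nhds_iff.1 (harc.eventually hev)
  have hQ : ∀ t : ℝ, |t| < ρ → ∃ Q : C(X, PlaneEnd), ‖Q - P‖ ≤ ε ∧
      IsDominatedAlong T (rotated A (Real.arctan t)) Q n := fun t ht => by
    obtain ⟨Q, hQ, hQd⟩ := hball (y := t) (by simpa using ht)
    refine ⟨Q, ?_, hQd⟩
    have h1 : dist Q P ≤ ε := hQ
    exact (dist_eq_norm Q P).symm.trans_le h1
  set f : ℝ → ℝ := fun t => upperLyapunovExponent μ T (rotated A (Real.arctan t)) -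
    upperLyapunovExponent μ T A - Real.log (Real.cos (Real.arctan t))
  have hcount := fun S : Set ℝ => h.exists_hasSum_countable hA hpos hT hρ hε hεP hQ (S := S)
  have hrat : (Set.range ((↑) : ℚ → ℝ)).Countable := Set.countable_range _
  obtain ⟨a, ha2, hak, has⟩ := hcount _ hrat
  have hcont : ∀ b : ℕ → ℝ, (∀ k, |b k| ≤ (ρ⁻¹) ^ k) →
      ContinuousOn (fun t : ℝ => ∑' k, b k * t ^ k) (Metric.ball 0 ρ) := fun b hb => by
    have := (hasFPowerSeriesOnBall_tsum hρ hb).continuousOn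
    rwa [Metric.eball_ofReal] at this
  -- the power series obtained from the rationals is also the one for every other parameter
  have hall : ∀ t, |t| < ρ → ∑' k, a k * t ^ k = f t := fun t ht => by
    obtain ⟨b, -, hbk, hbs⟩ := hcount _ (hrat.insert t)
    have heq : Set.EqOn (fun t : ℝ => ∑' k, a k * t ^ k) (fun t : ℝ => ∑' k, b k * t ^ k)
        (Metric.ball 0 ρ ∩ Set.range ((↑) : ℚ → ℝ)) := fun s hs => by
      have hs' : |s| < ρ := by simpa using hs.1
      exact (has s hs.2 hs').tsum_eq.trans
        (hbs s (Set.mem_insert_of_mem _ hs.2) hs').tsum_eq.symm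
    have heq' := heq.of_subset_closure (hcont a hak) (hcont b hbk) Set.inter_subset_left
      (Rat.denseRange_cast.open_subset_closure_inter Metric.isOpen_ball)
    exact (heq' (by simpa using ht)).trans (hbs t (Set.mem_insert _ _) ht).tsum_eq
  refine ⟨fun t => ∑' k, a k * t ^ k, (hasFPowerSeriesOnBall_tsum hρ hak).analyticAt,
    by rw [deriv_deriv_tsum hρ hak]; linarith, ?_⟩
  have htan : Tendsto Real.tan (𝓝 0) (𝓝 0) := by
    have : ContinuousAt Real.tan 0 := Real.continuousAt_tan.2 (by simp)
    simpa [ContinuousAt] using this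
  filter_upwards [htan.eventually (Metric.ball_mem_nhds 0 hρ),
    Ioo_mem_nhds (show -(Real.pi / 2) < 0 by linarith [Real.pi_pos])
      (show 0 < Real.pi / 2 by linarith [Real.pi_pos])] with φ h1 h2
  have h3 := hall (Real.tan φ) (by simpa using h1)
  simp only [f, Real.arctan_tan h2.1 h2.2] at h3
  rw [h3]
  ring

end Expansion

/-! ### Openness, analyticity and strict concavity -/

section Conclusion

/-- The local form of the exponent gives second derivative at most that of `log ∘ cos`, which is
`-1` at `0`. -/
theorem deriv_deriv_log_cos_add_le {G : ℝ → ℝ} (hG : AnalyticAt ℝ G 0)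
    (hG2 : deriv (deriv G) 0 ≤ 0) (c : ℝ) :
    deriv (deriv fun φ => c + Real.log (Real.cos φ) + G (Real.tan φ)) 0 ≤ -1 := by
  have htan0 : Tendsto Real.tan (𝓝 0) (𝓝 0) := by
    have : ContinuousAt Real.tan 0 := Real.continuousAt_tan.2 (by simp)
    simpa [ContinuousAt] using this
  have hcos : ∀ᶠ φ in 𝓝 (0 : ℝ), Real.cos φ ≠ 0 :=
    Real.continuous_cos.continuousAt.eventually_ne (by simp)
  have h1 : (deriv fun φ => c + Real.log (Real.cos φ) + G (Real.tan φ)) =ᶠ[𝓝 0]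
      fun φ => -Real.sin φ / Real.cos φ + deriv G (Real.tan φ) * (1 / Real.cos φ ^ 2) := by
    filter_upwards [hcos, htan0.eventually hG.eventually_analyticAt] with φ hφ hGφ
    have e1 := (Real.hasDerivAt_cos φ).log hφ
    have e2 := hGφ.differentiableAt.hasDerivAt.comp φ (Real.hasDerivAt_tan hφ)
    exact ((e1.const_add c).add e2).deriv
  rw [h1.deriv_eq]
  have hG' : HasDerivAt (deriv G) (deriv (deriv G) 0) (Real.tan 0) := by
    rw [Real.tan_zero]; exact hG.deriv.differentiableAt.hasDerivAt
  have e3 := hG'.comp 0 (Real.hasDerivAt_tan (x := 0) (by simp))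
  have e4 : HasDerivAt (fun φ => 1 / Real.cos φ ^ 2) 0 0 := by
    have := ((Real.hasDerivAt_cos 0).fun_pow 2).fun_inv (by simp)
    simpa [one_div] using this
  have e5 : HasDerivAt (fun φ => -Real.sin φ / Real.cos φ) (-1) 0 := by
    have := (Real.hasDerivAt_sin 0).fun_neg.fun_div (Real.hasDerivAt_cos 0) (by simp)
    simpa using this
  have e6 := (e5.add (e3.mul e4)).deriv
  have e7 : deriv (fun φ => -Real.sin φ / Real.cos φ +
      deriv G (Real.tan φ) * (1 / Real.cos φ ^ 2)) 0 = -1 + deriv (deriv G) 0 := by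
    refine Eq.trans e6 ?_
    simp
  rw [e7]
  linarith

theorem rot_mem_glPos (θ : ℝ) : rot θ ∈ Matrix.GLPos (Fin 2) ℝ := by
  rw [Matrix.mem_glpos, Matrix.GeneralLinearGroup.val_det_apply]
  have : Real.cos θ * Real.cos θ + Real.sin θ * Real.sin θ = 1 := by
    nlinarith [Real.sin_sq_add_cos_sq θ]
  simp [rot, Matrix.GeneralLinearGroup.mkOfDetNeZero, Matrix.det_fin_two, this]

variable {X : Type*} [MetricSpace X] [CompactSpace X] {T : X ≃ₜ X} {A : X → GL (Fin 2) ℝ}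

/-- Near a dominated parameter `θ`, the rotated cocycle at `s` is the one at `θ` rotated by the
small angle `s - θ`. -/
theorem isOpen_setOf_hasDominatedSplitting_rotated (hA : Continuous A) :
    IsOpen {θ : ℝ | HasDominatedSplitting T (rotated A θ)} := by
  rw [isOpen_iff_mem_nhds]
  intro θ hθ
  obtain ⟨P, n, h⟩ := exists_isDominatedAlong hθ
  have hev := h.eventually_rotated (continuous_rotated hA θ) univ_mem
  have ht : Tendsto (fun s : ℝ => s - θ) (𝓝 θ) (𝓝 0) := by
    have := (continuous_sub_right θ).tendsto θ
    rwa [sub_self] at this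
  filter_upwards [ht.eventually hev] with s hs
  obtain ⟨Q, -, hQ⟩ := hs
  rw [rotated_rotated, add_sub_cancel] at hQ
  exact hQ.hasDominatedSplitting

/-- At a dominated parameter, the exponent is analytic with second derivative at most `-1`. -/
theorem analyticAt_upperLyapunovExponent_rotated [MeasurableSpace X] [BorelSpace X]
    {μ : Measure X} [IsProbabilityMeasure μ] (hT : Ergodic T μ) (hA : Continuous A)
    (hpos : ∀ x, A x ∈ Matrix.GLPos (Fin 2) ℝ) {θ : ℝ}
    (hθ : HasDominatedSplitting T (rotated A θ)) :
    AnalyticAt ℝ (fun s => upperLyapunovExponent μ T (rotated A s)) θ ∧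
      deriv (deriv fun s => upperLyapunovExponent μ T (rotated A s)) θ ≤ -1 := by
  obtain ⟨P, n, h⟩ := exists_isDominatedAlong hθ
  obtain ⟨G, hG, hG2, hev⟩ := h.exists_expansion (μ := μ) (continuous_rotated hA θ)
    (fun x => mul_mem (hpos x) (rot_mem_glPos θ)) hT
  set f : ℝ → ℝ := fun s => upperLyapunovExponent μ T (rotated A s) with hf
  simp only [rotated_rotated] at hev
  have hloc : (fun φ => f (θ + φ)) =ᶠ[𝓝 0]
      fun φ => f θ + Real.log (Real.cos φ) + G (Real.tan φ) := hev
  constructor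
  · have hG' : AnalyticAt ℝ (fun φ => G (Real.tan φ)) 0 := by
      have ht : AnalyticAt ℝ Real.tan 0 := by
        have : AnalyticAt ℝ (fun φ => Real.sin φ / Real.cos φ) 0 :=
          Real.analyticAt_sin.div Real.analyticAt_cos (by simp)
        exact this.congr (Eventually.of_forall fun φ => (Real.tan_eq_sin_div_cos φ).symm)
      exact AnalyticAt.fun_comp (by rwa [Real.tan_zero]) ht
    have hlc : AnalyticAt ℝ (fun φ => Real.log (Real.cos φ)) 0 :=
      Real.analyticAt_cos.log (by simp)
    have h0 : AnalyticAt ℝ (fun φ => f (θ + φ)) 0 :=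
      ((analyticAt_const.add hlc).add hG').congr hloc.symm
    have hs : AnalyticAt ℝ (fun s : ℝ => s - θ) θ := analyticAt_id.sub analyticAt_const
    have := AnalyticAt.fun_comp (f := fun s : ℝ => s - θ) (g := fun φ => f (θ + φ)) (x := θ)
      (by rwa [sub_self]) hs
    simpa [Function.comp_def] using this
  · have e : deriv (deriv f) θ = deriv (deriv fun φ => f (θ + φ)) 0 := by
      have : (deriv fun φ => f (θ + φ)) = fun φ => deriv f (θ + φ) :=
        funext fun φ => deriv_comp_const_add f θ φ
      rw [this, deriv_comp_const_add, add_zero]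
    rw [e, hloc.deriv.deriv_eq]
    exact deriv_deriv_log_cos_add_le hG hG2 _

end Conclusion

end LinearCocycle

theorem mainTheorem1 {X : Type*} [MetricSpace X] [CompactSpace X] [MeasurableSpace X]
    [BorelSpace X] (T : X ≃ₜ X) (μ : Measure X) [IsProbabilityMeasure μ] (hT : Ergodic T μ)
    (A : X → GL (Fin 2) ℝ) (hA : Continuous A) (hpos : ∀ x, A x ∈ Matrix.GLPos (Fin 2) ℝ)
    (hdom : LinearCocycle.HasDominatedSplitting T A) :
    ∃ U : Set ℝ, IsOpen U ∧ (0 : ℝ) ∈ U ∧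
      (∀ θ : ℝ, θ ∈ U ↔ LinearCocycle.HasDominatedSplitting T (LinearCocycle.rotated A θ)) ∧
      (∀ θ ∈ U, LinearCocycle.IsUpperLyapunovExponent μ T (LinearCocycle.rotated A θ)
        (LinearCocycle.upperLyapunovExponent μ T (LinearCocycle.rotated A θ))) ∧
      AnalyticOnNhd ℝ
        (fun θ => LinearCocycle.upperLyapunovExponent μ T (LinearCocycle.rotated A θ)) U ∧
      (∀ I : Set ℝ, I ⊆ U → Convex ℝ I → StrictConcaveOn ℝ I
        (fun θ => LinearCocycle.upperLyapunovExponent μ T (LinearCocycle.rotated A θ))) := by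
  have hloc := fun (θ : ℝ) (hθ : LinearCocycle.HasDominatedSplitting T
    (LinearCocycle.rotated A θ)) =>
    LinearCocycle.analyticAt_upperLyapunovExponent_rotated (μ := μ) hT hA hpos hθ
  refine ⟨{θ | LinearCocycle.HasDominatedSplitting T (LinearCocycle.rotated A θ)},
    LinearCocycle.isOpen_setOf_hasDominatedSplitting_rotated hA, ?_, fun θ => Iff.rfl, ?_,
    fun θ hθ => (hloc θ hθ).1, fun I hIU hI => ?_⟩
  · change LinearCocycle.HasDominatedSplitting T (LinearCocycle.rotated A 0)
    rwa [LinearCocycle.rotated_zero]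
  · intro θ hθ
    obtain ⟨P, n, h⟩ := LinearCocycle.exists_isDominatedAlong hθ
    have hL := h.isUpperLyapunovExponent (LinearCocycle.continuous_rotated hA θ) hT
    rwa [LinearCocycle.upperLyapunovExponent_eq hL]
  · refine strictConcaveOn_of_deriv2_neg' hI
      (fun θ hθ => (hloc θ (hIU hθ)).1.continuousAt.continuousWithinAt) fun θ hθ => ?_
    exact lt_of_le_of_lt (hloc θ (hIU hθ)).2 (by norm_num)
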